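/- Let $(X,Y)$ be a pair of real random variables with $Y$ not almost surely constant, and let $(X_1,Y_1),(X_2,Y_2),\dots$ be i.i.d. copies of $(X,Y)$. Let $h$ and $F$ satisfy the following two conditions. (C1) $h:[0,1]^2\to[0,\infty)$ is continuous and symmetric, $h(x,x)=0$ for all $x\in[0,1]$, and $h(x,y)>0$ for all $x\neq y$ in $[0,1]$. (C2) $F:\mathbb{R}\to(0,1)$ is a continuous, strictly increasing cumulative distribution function. For each $n$, let $(X_{(1)},Y_{[1]}),\dots,(X_{(n)},Y_{[n]})$ be the pairs $(X_1,Y_1),\dots,(X_n,Y_n)$ reordered so that $X_{(1)}\le\dots\le X_{(n)}$, ties among the $X_i$ being broken uniformly at random, and put $$\xi_n^{(h,F)} = 1-\frac{n\sum_{i=1}^{n-1}h\big(F(Y_{[i]}),F(Y_{[i+1]})\big)}{\sum_{i=1}^n\sum_{j=1}^n h\big(F(Y_i),F(Y_j)\big)},$$ with $\xi_n^{(h,F)}=1$ if the denominator is $0$. If $X$ and $Y$ are independent, then $$\sigma^2=\frac{\mathbb{E}\big[h(F(Y_1),F(Y_2))^2\big]-2\,\mathbb{E}\big[h(F(Y_1),F(Y_2))\,h(F(Y_1),F(Y_3))\big]+\big(\mathbb{E}\,h(F(Y_1),F(Y_2))\big)^2}{\big(\mathbb{E}\,h(F(Y_1),F(Y_2))\big)^2}$$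 is strictly positive, and $\sqrt{n}\,\xi_n^{(h,F)}$ converges in distribution to $N(0,\sigma^2)$ as $n\to\infty$. -/

import Mathlib

open MeasureTheory ProbabilityTheory Filter

open scoped ENNReal

/-- Regularity of `h`: the function `h : [0,1]² → [0,∞)` is continuous and symmetric, vanishes on the diagonal and
is strictly positive off the diagonal. Values of `h` outside `[0,1]²` play no role. -/
structure RegularKernel (h : ℝ → ℝ → ℝ) : Prop where
  nonneg : ∀ x ∈ Set.Icc (0 : ℝ) 1, ∀ y ∈ Set.Icc (0 : ℝ) 1, 0 ≤ h x y
  continuousOn : ContinuousOn (fun p : ℝ × ℝ => h p.1 p.2) (Set.Icc (0 : ℝ) 1 ×ˢ Set.Icc (0 : ℝ) 1)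
  symm : ∀ x ∈ Set.Icc (0 : ℝ) 1, ∀ y ∈ Set.Icc (0 : ℝ) 1, h x y = h y x
  diag : ∀ x ∈ Set.Icc (0 : ℝ) 1, h x x = 0
  pos : ∀ x ∈ Set.Icc (0 : ℝ) 1, ∀ y ∈ Set.Icc (0 : ℝ) 1, x ≠ y → 0 < h x y

/-- Regularity of `F`: the function `F : ℝ → (0,1)` is a continuous and strictly increasing c.d.f. -/
structure RegularCdf (F : ℝ → ℝ) : Prop where
  isCdf : ∃ ν : Measure ℝ, IsProbabilityMeasure ν ∧ ∀ x, F x = cdf ν x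
  mem_Ioo : ∀ x, F x ∈ Set.Ioo (0 : ℝ) 1
  continuous : Continuous F
  strictMono : StrictMono F

/-- The variation statistic `ζ_n = n⁻¹ ∑_{i=1}^{n-1} h(F(Y_[i]), F(Y_[i+1]))` of a reordered sample
`(Y_[1], …, Y_[n])`. -/
noncomputable def zetaStat (h : ℝ → ℝ → ℝ) (F : ℝ → ℝ) {n : ℕ} (y : Fin n → ℝ) : ℝ :=
  1 / (n : ℝ) * ∑ i : Fin (n - 1),
    h (F (y ⟨(i : ℕ), by omega⟩)) (F (y ⟨(i : ℕ) + 1, by omega⟩))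

/-- The normalization statistic `χ_n = n⁻² ∑_{i=1}^n ∑_{j=1}^n h(F(Y_i), F(Y_j))`. -/
noncomputable def chiStat (h : ℝ → ℝ → ℝ) (F : ℝ → ℝ) {n : ℕ} (y : Fin n → ℝ) : ℝ :=
  1 / (n : ℝ) ^ 2 * ∑ i : Fin n, ∑ j : Fin n, h (F (y i)) (F (y j))

open Classical in
/-- The correlation coefficient `ξ_n = 1 - ζ_n / χ_n` of the sample `y`, reordered by the
permutation `π` (so `Y_[i] = y (π i)`); it is `1` if `χ_n = 0`. -/
noncomputable def xiStat (h : ℝ → ℝ → ℝ) (F : ℝ → ℝ) {n : ℕ} (y : Fin n → ℝ)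
    (π : Equiv.Perm (Fin n)) : ℝ :=
  if chiStat h F y = 0 then 1 else 1 - zetaStat h F (fun i => y (π i)) / chiStat h F y

/-- The permutations which arrange `x` in nondecreasing order. -/
def sortingPerms {n : ℕ} (x : Fin n → ℝ) : Set (Equiv.Perm (Fin n)) :=
  {σ | Monotone fun i => x (σ i)}

/-- `π` is a random ordering of the sample `(x_1,y_1), …, (x_n,y_n)` with `x_(1) ≤ … ≤ x_(n)`, ties
being broken uniformly at random: the conditional law of `π` given the sample is the uniform
distribution on the set of all permutations which sort the `x_i`. -/
structure IsUniformOrdering {Ω : Type*} [MeasurableSpace Ω] (P : Measure Ω) {n : ℕ}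
    (x y : Fin n → Ω → ℝ) (π : Ω → Equiv.Perm (Fin n)) : Prop where
  measurableSet_eq : ∀ σ : Equiv.Perm (Fin n), MeasurableSet {ω | π ω = σ}
  sorts : ∀ ω, π ω ∈ sortingPerms fun i => x i ω
  condLaw : ∀ σ : Equiv.Perm (Fin n), ∀ B : Set (Fin n → ℝ × ℝ), MeasurableSet B →
    P {ω | (fun i => (x i ω, y i ω)) ∈ B ∧ π ω = σ} =
      ∫⁻ ω in {ω | (fun i => (x i ω, y i ω)) ∈ B},
        (sortingPerms fun i => x i ω).indicator
          (fun _ => ((sortingPerms fun i => x i ω).ncard : ℝ≥0∞)⁻¹) σ ∂P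

/-- The asymptotic variance
`(E h(F(Y₁),F(Y₂))² - 2 E[h(F(Y₁),F(Y₂)) h(F(Y₁),F(Y₃))] + (E h(F(Y₁),F(Y₂)))²) /
  (E h(F(Y₁),F(Y₂)))²`. -/
noncomputable def sigmaSq {Ω : Type*} [MeasurableSpace Ω] (P : Measure Ω) (h : ℝ → ℝ → ℝ)
    (F : ℝ → ℝ) (Y₁ Y₂ Y₃ : Ω → ℝ) : ℝ :=
  ((∫ ω, (h (F (Y₁ ω)) (F (Y₂ ω))) ^ 2 ∂P)
      - 2 * (∫ ω, h (F (Y₁ ω)) (F (Y₂ ω)) * h (F (Y₁ ω)) (F (Y₃ ω)) ∂P)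
      + (∫ ω, h (F (Y₁ ω)) (F (Y₂ ω)) ∂P) ^ 2)
    / (∫ ω, h (F (Y₁ ω)) (F (Y₂ ω)) ∂P) ^ 2

/-!
Write `H a b = h (F a) (F b)`, a bounded continuous symmetric kernel that vanishes exactly on the
diagonal, and let `ν` be the law of `Y`.

*Removing the ordering.* Since the vector of the `X_i` is independent of the exchangeable vector
of the `Y_i`, a random ordering that, given the sample, is drawn from a law depending only on the
`X_i` leaves the law of the `Y`-vector unchanged (`IsUniformOrdering.map_comp_eq`), and the
normalization `χ_n` is invariant under permutations. So the reordered sample may be replaced by the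
original one.

*Hoeffding decomposition.* With `p x = ∫ H x y ∂ν y` and `μ = ∫ p ∂ν`, the kernel
`g x y = H x y - p x - p y + μ` integrates to zero in each variable. The linear parts of `χ_n` and
`ζ_n` cancel up to boundary terms: `√n (χ_n - ζ_n)` equals `-n^(-1/2) ∑ g (Y_i) (Y_(i+1))` plus
`√n` times a degenerate V-statistic plus a boundary term of order `n^(-1/2)`
(`sqrt_mul_pairMean_sub_stepMean`). The V-statistic is negligible because in the second moment of
`∑ ∑ g (Y_i) (Y_j)` only `O(n²)` quadruples of indices contribute (`integral_sq_double_sum_le`).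

*Central limit theorem for the chain.* The sums `∑ g (Y_j) (Y_(j+1))` have martingale difference
increments. Their characteristic function is handled by a perturbed eigenfunction: with
`v x = ∫ (g x y)² ∂ν y`, `s² = ∫ v ∂ν` and `w = 1 - θ² (v - s²) / 2`, the transfer operator
`f ↦ (x ↦ ∫ exp (i θ g x y) f y ∂ν y)` sends `w` to `(1 - θ² s² / 2) w` up to an error of order
`θ³`, so that `E exp (i θ ∑_(j<k) g (Y_j) (Y_(j+1)))` is `(1 - θ² s² / 2)^k` up to
`O(k θ³ + θ²)` (`norm_integral_exp_chain_sub_pow_le`). With `θ = t / √n`, Lévy's theorem gives the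
normal limit (`tendstoInDistribution_chain`). As `χ_n → μ` in probability, Slutsky's theorem gives
`√n ξ_n → N(0, s² / μ²)`, and `s² / μ²` is the asserted variance
(`integral_condSecondMoment_degeneratePart`).

*Positivity.* `μ > 0` because `Y` is not constant. If `s² = 0`, then by continuity `g` vanishes at
`(x, x)` for `ν`-almost every `x` in the support of `ν`; there `H x x = 0` forces `p x = μ / 2`, and
integrating yields `μ = μ / 2`, a contradiction.
-/

/-! ### Central limit theorem for sums along consecutive observations -/

section Chain

variable {Ω S T : Type*} [MeasurableSpace Ω] [MeasurableSpace S] [MeasurableSpace T]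
  {P : Measure Ω} [IsProbabilityMeasure P] {ν : Measure S} [IsProbabilityMeasure ν]

lemma integrable_of_measurable_of_norm_le {E : Type*} [NormedAddCommGroup E] [MeasurableSpace E]
    [BorelSpace E] [SecondCountableTopology E] {f : Ω → E} (hf : Measurable f) {C : ℝ}
    (hC : ∀ ω, ‖f ω‖ ≤ C) : Integrable f P :=
  Integrable.of_bound hf.aestronglyMeasurable C (ae_of_all _ hC)

/-- If `V` is independent of `Z` and `m z ·` is centred under the law of `V` for every `z`, then
`m (Z, V)` has mean zero. The orthogonality relations below are instances. -/
lemma integral_comp_eq_zero_of_indepFun {E : Type*} [NormedAddCommGroup E] [NormedSpace ℝ E]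
    [MeasurableSpace E] [BorelSpace E] [SecondCountableTopology E]
    {Z : Ω → T} {V : Ω → S} (hZ : Measurable Z) (hV : Measurable V) (hZV : IndepFun Z V P)
    (hlaw : P.map V = ν) {m : T → S → E} (hm : Measurable (Function.uncurry m)) {C : ℝ}
    (hC : ∀ z y, ‖m z y‖ ≤ C) (h0 : ∀ z, ∫ y, m z y ∂ν = 0) :
    ∫ ω, m (Z ω) (V ω) ∂P = 0 := by
  have h1 := (indepFun_iff_map_prod_eq_prod_map_map hZ.aemeasurable hV.aemeasurable).1 hZV
  have := Measure.isProbabilityMeasure_map (μ := P) hZ.aemeasurable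
  have h2 : ∫ ω, m (Z ω) (V ω) ∂P = ∫ p, Function.uncurry m p ∂(P.map fun ω => (Z ω, V ω)) := by
    rw [integral_map (hZ.prodMk hV).aemeasurable hm.aestronglyMeasurable]
    rfl
  rw [h2, h1, hlaw, integral_prod _ (integrable_of_measurable_of_norm_le hm fun p => hC p.1 p.2)]
  simp [Function.uncurry, h0]

omit [IsProbabilityMeasure P] in
lemma indepFun_restrict_of_notMem {Y : ℕ → Ω → S} (hY : iIndepFun Y P)
    (hm : ∀ i, Measurable (Y i)) {s : Finset ℕ} {j : ℕ} (hj : j ∉ s) :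
    IndepFun (fun ω (i : s) => Y i ω) (Y j) P :=
  (hY.indepFun_finset s {j} (by simpa using hj) hm).comp measurable_id
    (measurable_pi_apply (⟨j, by simp⟩ : ({j} : Finset ℕ)))

/-- One step of the transfer operator, expanded to second order. Here `a = θ g x y`, while `p`, `q`,
`r` are `θ² / 2` times `v x`, `v y` and `s²`, and `u` bounds `|θ g|`; the remainder is of third
order. -/
lemma norm_exp_mul_I_expansion_le {u a p q r : ℝ} (hu0 : 0 ≤ u) (hu1 : u ≤ 1) (ha : |a| ≤ u)
    (hp : p ∈ Set.Icc 0 (u ^ 2 / 2)) (hq : q ∈ Set.Icc 0 (u ^ 2 / 2))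
    (hr : r ∈ Set.Icc 0 (u ^ 2 / 2)) :
    ‖Complex.exp (a * Complex.I) * ((1 - (q - r) : ℝ) : ℂ)
        - ((1 - r : ℝ) : ℂ) * ((1 - (p - r) : ℝ) : ℂ)
        - ((a : ℂ) * Complex.I - ((a ^ 2 / 2 - p : ℝ) : ℂ) - ((q - r : ℝ) : ℂ))‖ ≤ 8 * u ^ 3 := by
  set ρ : ℂ := Complex.exp (a * Complex.I) - (1 + a * Complex.I - (a : ℂ) ^ 2 / 2) with hρ
  have hna : ‖(a : ℂ) * Complex.I‖ ≤ u := by simpa using ha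
  have hρ3 : ‖ρ‖ ≤ 3 * u ^ 3 := by
    have h := Complex.norm_exp_sub_sum_le_norm_mul_exp (a * Complex.I) 3
    have e : (∑ m ∈ Finset.range 3, ((a : ℂ) * Complex.I) ^ m / (m.factorial : ℂ))
        = 1 + a * Complex.I - (a : ℂ) ^ 2 / 2 := by
      simp [Finset.sum_range_succ, mul_pow, Nat.factorial]
      ring
    rw [e] at h
    have h3 : Real.exp ‖(a : ℂ) * Complex.I‖ ≤ 3 :=
      (Real.exp_le_exp.2 (hna.trans hu1)).trans (by linarith [Real.exp_one_lt_d9])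
    calc ‖ρ‖ ≤ ‖(a : ℂ) * Complex.I‖ ^ 3 * Real.exp ‖(a : ℂ) * Complex.I‖ := h
      _ ≤ u ^ 3 * 3 := by gcongr
      _ = 3 * u ^ 3 := by ring
  have key : Complex.exp (a * Complex.I) * ((1 - (q - r) : ℝ) : ℂ)
        - ((1 - r : ℝ) : ℂ) * ((1 - (p - r) : ℝ) : ℂ)
        - ((a : ℂ) * Complex.I - ((a ^ 2 / 2 - p : ℝ) : ℂ) - ((q - r : ℝ) : ℂ))
      = -((a : ℂ) * Complex.I) * ((q - r : ℝ) : ℂ)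
        + ((a ^ 2 / 2 * (q - r) - r * (p - r) : ℝ) : ℂ)
        + ρ * ((1 - (q - r) : ℝ) : ℂ) := by
    rw [hρ]; push_cast; ring
  have hd : |q - r| ≤ u ^ 2 / 2 := by
    rw [abs_le]; constructor <;> linarith [hq.1, hq.2, hr.1, hr.2]
  have hd' : |p - r| ≤ u ^ 2 / 2 := by
    rw [abs_le]; constructor <;> linarith [hp.1, hp.2, hr.1, hr.2]
  have hu2 : u ^ 2 ≤ 1 := by nlinarith
  have hu3 : (0:ℝ) ≤ u ^ 3 := by positivity
  have hu4 : u ^ 4 ≤ u ^ 3 := by nlinarith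
  have b1 : ‖-((a : ℂ) * Complex.I) * ((q - r : ℝ) : ℂ)‖ ≤ u * (u ^ 2 / 2) := by
    rw [norm_mul, norm_neg, Complex.norm_real, Real.norm_eq_abs]
    gcongr
  have b2 : ‖((a ^ 2 / 2 * (q - r) - r * (p - r) : ℝ) : ℂ)‖
      ≤ u ^ 2 / 2 * (u ^ 2 / 2) + u ^ 2 / 2 * (u ^ 2 / 2) := by
    rw [Complex.norm_real, Real.norm_eq_abs]
    refine (abs_sub _ _).trans ?_
    rw [abs_mul, abs_mul, abs_of_nonneg hr.1, abs_of_nonneg (by positivity : 0 ≤ a ^ 2 / 2),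
      ← sq_abs a]
    have := hr.2
    gcongr
  have b3 : ‖ρ * ((1 - (q - r) : ℝ) : ℂ)‖ ≤ 3 * u ^ 3 * (3 / 2) := by
    rw [norm_mul, Complex.norm_real, Real.norm_eq_abs]
    have : |1 - (q - r)| ≤ 3 / 2 := by
      rw [abs_le] at hd ⊢; constructor <;> linarith
    gcongr
  rw [key]
  refine (norm_add₃_le.trans (add_le_add_three b1 b2 b3)).trans ?_
  nlinarith

/-- The conditional second moment `x ↦ ∫ (g x y)² ∂ν y`, that is, `E[g (Y₁) (Y₂)² | Y₁ = x]` for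
independent `Y₁`, `Y₂` with law `ν`. -/
noncomputable def condSecondMoment (ν : Measure S) (g : S → S → ℝ) (x : S) : ℝ :=
  ∫ y, g x y ^ 2 ∂ν

lemma condSecondMoment_mem_Icc {g : S → S → ℝ} (hg : Measurable (Function.uncurry g)) {C : ℝ}
    (hC : ∀ x y, |g x y| ≤ C) (x : S) : condSecondMoment ν g x ∈ Set.Icc 0 (C ^ 2) := by
  refine ⟨integral_nonneg fun y => sq_nonneg _, ?_⟩
  have hm : Measurable fun y => g x y ^ 2 := (hg.of_uncurry_left (x := x)).pow_const 2
  have hb : ∀ y, g x y ^ 2 ≤ C ^ 2 := fun y => sq_le_sq' (abs_le.1 (hC x y)).1 (abs_le.1 (hC x y)).2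
  have hi : Integrable (fun y => g x y ^ 2) ν :=
    integrable_of_measurable_of_norm_le hm (C := C ^ 2) fun y => by
      rw [Real.norm_eq_abs, abs_of_nonneg (sq_nonneg _)]; exact hb y
  simpa [condSecondMoment] using integral_mono hi (integrable_const (C ^ 2)) hb

lemma measurable_condSecondMoment {g : S → S → ℝ} (hg : Measurable (Function.uncurry g)) :
    Measurable (condSecondMoment ν g) :=
  ((hg.pow_const 2).stronglyMeasurable.integral_prod_right (ν := ν)).measurable

lemma integrable_condSecondMoment {g : S → S → ℝ} (hg : Measurable (Function.uncurry g))
    {C : ℝ} (hC : ∀ x y, |g x y| ≤ C) : Integrable (condSecondMoment ν g) ν :=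
  integrable_of_measurable_of_norm_le (measurable_condSecondMoment hg) (C := C ^ 2) fun x => by
    have h := condSecondMoment_mem_Icc (ν := ν) hg hC x
    rw [Real.norm_eq_abs, abs_of_nonneg h.1]; exact h.2

lemma integral_condSecondMoment_mem_Icc {g : S → S → ℝ} (hg : Measurable (Function.uncurry g))
    {C : ℝ} (hC : ∀ x y, |g x y| ≤ C) :
    ∫ x, condSecondMoment ν g x ∂ν ∈ Set.Icc 0 (C ^ 2) := by
  have h := condSecondMoment_mem_Icc (ν := ν) hg hC
  refine ⟨integral_nonneg fun x => (h x).1, ?_⟩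
  simpa using integral_mono (integrable_condSecondMoment hg hC) (integrable_const (C ^ 2))
    fun x => (h x).2

/-- The perturbed eigenfunction `w = 1 - θ² (v - s²) / 2` of the transfer operator
`f ↦ (x ↦ ∫ exp (i θ g x y) f y ∂ν y)`, where `v` is the conditional second moment of `g` and `s²`
its mean. -/
noncomputable def chainCorrector (ν : Measure S) (g : S → S → ℝ) (θ : ℝ) (x : S) : ℝ :=
  1 - (θ ^ 2 / 2 * condSecondMoment ν g x - θ ^ 2 / 2 * ∫ x, condSecondMoment ν g x ∂ν)

/-- The part of `exp (i θ g x y) w y - (1 - θ² s² / 2) w x` of order at most `θ²`, where `w` is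
`chainCorrector`. Its integral in `y` vanishes when that of `g` does; this is what determines the
choice of `w`. -/
noncomputable def chainFluctuation (ν : Measure S) (g : S → S → ℝ) (θ : ℝ) (x y : S) : ℂ :=
  ((θ * g x y : ℝ) : ℂ) * Complex.I
    - (((θ * g x y) ^ 2 / 2 - θ ^ 2 / 2 * condSecondMoment ν g x : ℝ) : ℂ)
    - ((θ ^ 2 / 2 * condSecondMoment ν g y
        - θ ^ 2 / 2 * ∫ x, condSecondMoment ν g x ∂ν : ℝ) : ℂ)

lemma half_sq_mul_mem_Icc {θ C c : ℝ} (hc : c ∈ Set.Icc 0 (C ^ 2)) :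
    θ ^ 2 / 2 * c ∈ Set.Icc 0 ((|θ| * C) ^ 2 / 2) := by
  obtain ⟨hc0, hc1⟩ := hc
  refine ⟨by positivity, ?_⟩
  rw [mul_pow, sq_abs]
  nlinarith [sq_nonneg θ]

lemma measurable_chainCorrector {g : S → S → ℝ} (hg : Measurable (Function.uncurry g)) (θ : ℝ) :
    Measurable (chainCorrector ν g θ) := by
  have := measurable_condSecondMoment (ν := ν) hg
  unfold chainCorrector
  fun_prop

lemma abs_chainCorrector_sub_one_le {g : S → S → ℝ} (hg : Measurable (Function.uncurry g)) {C : ℝ}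
    (hC : ∀ x y, |g x y| ≤ C) (θ : ℝ) (x : S) :
    |chainCorrector ν g θ x - 1| ≤ (|θ| * C) ^ 2 / 2 := by
  have h1 := half_sq_mul_mem_Icc (θ := θ) (condSecondMoment_mem_Icc (ν := ν) hg hC x)
  have h2 := half_sq_mul_mem_Icc (θ := θ) (integral_condSecondMoment_mem_Icc (ν := ν) hg hC)
  unfold chainCorrector
  rw [abs_le]
  constructor <;> linarith [h1.1, h1.2, h2.1, h2.2]

lemma integral_chainCorrector {g : S → S → ℝ} (hg : Measurable (Function.uncurry g)) {C : ℝ}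
    (hC : ∀ x y, |g x y| ≤ C) (θ : ℝ) : ∫ x, chainCorrector ν g θ x ∂ν = 1 := by
  have iv := integrable_condSecondMoment (ν := ν) hg hC
  unfold chainCorrector
  rw [integral_sub (integrable_const _), integral_sub (iv.const_mul _) (integrable_const _),
    integral_const_mul]
  · simp
  · exact (iv.const_mul _).sub (integrable_const _)

lemma measurable_chainFluctuation {g : S → S → ℝ} (hg : Measurable (Function.uncurry g)) (θ : ℝ) :
    Measurable (Function.uncurry (chainFluctuation ν g θ)) := by
  have h1 : Measurable fun p : S × S => g p.1 p.2 := hg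
  have h2 := measurable_condSecondMoment (ν := ν) hg
  unfold chainFluctuation
  simp only [Function.uncurry_def]
  fun_prop

lemma norm_chainFluctuation_le {g : S → S → ℝ} (hg : Measurable (Function.uncurry g)) {C : ℝ}
    (hC : ∀ x y, |g x y| ≤ C) {θ : ℝ} (hθ : |θ| * C ≤ 1) (x y : S) :
    ‖chainFluctuation ν g θ x y‖ ≤ 3 := by
  have e0 : 0 ≤ |θ| * C := mul_nonneg (abs_nonneg _) ((abs_nonneg _).trans (hC x y))
  have e1 : |θ * g x y| ≤ |θ| * C := by
    rw [abs_mul]; exact mul_le_mul_of_nonneg_left (hC x y) (abs_nonneg _)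
  have e2 : (θ * g x y) ^ 2 ≤ (|θ| * C) ^ 2 := sq_le_sq' (abs_le.1 e1).1 (abs_le.1 e1).2
  have e3 := half_sq_mul_mem_Icc (θ := θ) (condSecondMoment_mem_Icc (ν := ν) hg hC x)
  have e4 := half_sq_mul_mem_Icc (θ := θ) (condSecondMoment_mem_Icc (ν := ν) hg hC y)
  have e5 := half_sq_mul_mem_Icc (θ := θ) (integral_condSecondMoment_mem_Icc (ν := ν) hg hC)
  have e6 : (|θ| * C) ^ 2 ≤ 1 := pow_le_one₀ e0 hθ
  have f1 : ‖((θ * g x y : ℝ) : ℂ) * Complex.I‖ ≤ 1 := by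
    rw [norm_mul, Complex.norm_I, mul_one, Complex.norm_real]; exact e1.trans hθ
  have f2 : ‖(((θ * g x y) ^ 2 / 2 - θ ^ 2 / 2 * condSecondMoment ν g x : ℝ) : ℂ)‖ ≤ 1 := by
    rw [Complex.norm_real, Real.norm_eq_abs, abs_le]
    constructor <;> linarith [e3.1, e3.2, sq_nonneg (θ * g x y)]
  have f3 : ‖((θ ^ 2 / 2 * condSecondMoment ν g y
      - θ ^ 2 / 2 * ∫ x, condSecondMoment ν g x ∂ν : ℝ) : ℂ)‖ ≤ 1 := by
    rw [Complex.norm_real, Real.norm_eq_abs, abs_le]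
    constructor <;> linarith [e4.1, e4.2, e5.1, e5.2]
  refine (norm_sub_le _ _).trans ?_
  linarith [norm_sub_le (((θ * g x y : ℝ) : ℂ) * Complex.I)
    (((θ * g x y) ^ 2 / 2 - θ ^ 2 / 2 * condSecondMoment ν g x : ℝ) : ℂ)]

lemma integral_chainFluctuation {g : S → S → ℝ} (hg : Measurable (Function.uncurry g)) {C : ℝ}
    (hC : ∀ x y, |g x y| ≤ C) (h0 : ∀ x, ∫ y, g x y ∂ν = 0) (θ : ℝ) (x : S) :
    ∫ y, chainFluctuation ν g θ x y ∂ν = 0 := by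
  have hgx : Measurable fun y => g x y := hg.of_uncurry_left
  have ig : Integrable (fun y => g x y) ν := integrable_of_measurable_of_norm_le hgx (hC x)
  have ig2 : Integrable (fun y => θ ^ 2 / 2 * g x y ^ 2) ν :=
    (integrable_of_measurable_of_norm_le (hgx.pow_const 2) (C := C ^ 2) fun y => by
      rw [norm_pow]; exact pow_le_pow_left₀ (norm_nonneg _) (hC x y) 2).const_mul _
  have iv := (integrable_condSecondMoment (ν := ν) hg hC).const_mul (θ ^ 2 / 2)
  have e : ∀ y, (θ * g x y) ^ 2 / 2 - θ ^ 2 / 2 * condSecondMoment ν g x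
      = θ ^ 2 / 2 * g x y ^ 2 - θ ^ 2 / 2 * condSecondMoment ν g x := fun y => by ring
  have j1 : Integrable (fun y => ((θ * g x y : ℝ) : ℂ) * Complex.I) ν :=
    (ig.const_mul θ).ofReal.mul_const _
  have j2 : Integrable (fun y =>
      ((θ ^ 2 / 2 * g x y ^ 2 - θ ^ 2 / 2 * condSecondMoment ν g x : ℝ) : ℂ)) ν :=
    (ig2.sub (integrable_const _)).ofReal
  have j3 : Integrable (fun y => ((θ ^ 2 / 2 * condSecondMoment ν g y
      - θ ^ 2 / 2 * ∫ x, condSecondMoment ν g x ∂ν : ℝ) : ℂ)) ν :=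
    (iv.sub (integrable_const _)).ofReal
  unfold chainFluctuation
  simp_rw [e]
  rw [integral_sub ?_ j3, integral_sub j1 j2, integral_mul_const]
  · simp only [integral_complex_ofReal]
    rw [integral_const_mul, h0, integral_sub ig2 (integrable_const _), integral_const_mul,
      integral_sub iv (integrable_const _), integral_const_mul]
    simp [condSecondMoment, integral_const_mul]
  · exact j1.sub j2

omit [IsProbabilityMeasure P] in
/-- The next observation is independent of the current partial sum and the current observation. -/
lemma indepFun_chain {Y : ℕ → Ω → S} (hY : iIndepFun Y P) (hYm : ∀ i, Measurable (Y i))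
    {g : S → S → ℝ} (hg : Measurable (Function.uncurry g)) (k : ℕ) :
    IndepFun (fun ω => (∑ j ∈ Finset.range k, g (Y j ω) (Y (j + 1) ω), Y k ω)) (Y (k + 1)) P := by
  have hφ : Measurable fun z : Finset.range (k + 1) → S =>
      (∑ j : Fin k, g (z ⟨j, by simp⟩) (z ⟨j + 1, by simp⟩), z ⟨k, by simp⟩) := by
    refine (Finset.measurable_fun_sum _ fun j _ => ?_).prodMk (measurable_pi_apply _)
    exact hg.comp (f := fun z : Finset.range (k + 1) → S => (z ⟨j, by simp⟩, z ⟨j + 1, by simp⟩))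
      ((measurable_pi_apply _).prodMk (measurable_pi_apply _))
  have h := (indepFun_restrict_of_notMem hY hYm (s := Finset.range (k + 1)) (j := k + 1)
    (by simp)).comp hφ measurable_id
  have e : (fun ω => (∑ j ∈ Finset.range k, g (Y j ω) (Y (j + 1) ω), Y k ω))
      = (fun z : Finset.range (k + 1) → S =>
        (∑ j : Fin k, g (z ⟨j, by simp⟩) (z ⟨j + 1, by simp⟩), z ⟨k, by simp⟩))
        ∘ fun ω i => Y i ω := by
    ext ω : 1
    simp [Finset.sum_range]
  rw [e]
  exact h

/-- The characteristic function of a sum along the chain is nearly a power: `a_k`, the mean of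
`exp (i θ S_k) w (Y_k)`, satisfies `|a_(k+1) - (1 - θ² s² / 2) a_k| = O(θ³)` with `a_0 = 1`, and
`w - 1 = O(θ²)`. -/
lemma norm_integral_exp_chain_sub_pow_le {Y : ℕ → Ω → S} (hY : iIndepFun Y P)
    (hYm : ∀ i, Measurable (Y i)) (hlaw : ∀ i, P.map (Y i) = ν)
    {g : S → S → ℝ} (hg : Measurable (Function.uncurry g)) {C : ℝ} (hC : ∀ x y, |g x y| ≤ C)
    (h0 : ∀ x, ∫ y, g x y ∂ν = 0) {θ : ℝ} (hθ : |θ| * C ≤ 1) (k : ℕ) :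
    ‖∫ ω, Complex.exp ((θ * ∑ j ∈ Finset.range k, g (Y j ω) (Y (j + 1) ω) : ℝ) * Complex.I) ∂P
        - ((1 - θ ^ 2 / 2 * ∫ x, condSecondMoment ν g x ∂ν : ℝ) : ℂ) ^ k‖
      ≤ k * (8 * (|θ| * C) ^ 3) + (|θ| * C) ^ 2 / 2 := by
  have hne : Nonempty S := nonempty_of_isProbabilityMeasure ν
  have hC0 : 0 ≤ C := (abs_nonneg _).trans (hC hne.some hne.some)
  have hsc : ∀ {c : ℝ}, c ∈ Set.Icc 0 (C ^ 2) → θ ^ 2 / 2 * c ∈ Set.Icc 0 ((|θ| * C) ^ 2 / 2) :=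
    half_sq_mul_mem_Icc
  have hvI := condSecondMoment_mem_Icc (ν := ν) hg hC
  have hrI := hsc (integral_condSecondMoment_mem_Icc (ν := ν) hg hC)
  have hwm := measurable_chainCorrector (ν := ν) hg θ
  have hw1 := abs_chainCorrector_sub_one_le (ν := ν) hg hC θ
  have hwint := integral_chainCorrector (ν := ν) hg hC θ
  have hmm := measurable_chainFluctuation (ν := ν) hg θ
  have hmb := norm_chainFluctuation_le (ν := ν) hg hC hθ
  have hm0 := integral_chainFluctuation (ν := ν) hg hC h0 θ
  have hwdef : ∀ x, chainCorrector ν g θ x = 1 - (θ ^ 2 / 2 * condSecondMoment ν g x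
    - θ ^ 2 / 2 * ∫ x, condSecondMoment ν g x ∂ν) := fun x => rfl
  have hmdef : ∀ x y, chainFluctuation ν g θ x y = ((θ * g x y : ℝ) : ℂ) * Complex.I
    - (((θ * g x y) ^ 2 / 2 - θ ^ 2 / 2 * condSecondMoment ν g x : ℝ) : ℂ)
    - ((θ ^ 2 / 2 * condSecondMoment ν g y
        - θ ^ 2 / 2 * ∫ x, condSecondMoment ν g x ∂ν : ℝ) : ℂ) := fun x y => rfl
  generalize chainCorrector ν g θ = w at hwm hw1 hwint hwdef
  generalize chainFluctuation ν g θ = m at hmm hmb hm0 hmdef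
  generalize condSecondMoment ν g = v at hvI hrI hwdef hmdef ⊢
  set u := |θ| * C
  have hu0 : 0 ≤ u := by positivity
  have hu21 : u ^ 2 ≤ 1 := pow_le_one₀ hu0 hθ
  set r := θ ^ 2 / 2 * ∫ x, v x ∂ν
  have hw2 : ∀ x, |w x| ≤ 2 := fun x => by
    have := hw1 x
    rw [abs_le] at this ⊢; constructor <;> linarith
  obtain ⟨ph, hph⟩ : ∃ ph : ℕ → Ω → ℂ, ∀ k ω, ph k ω =
      Complex.exp ((θ * ∑ j ∈ Finset.range k, g (Y j ω) (Y (j + 1) ω) : ℝ) * Complex.I) :=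
    ⟨_, fun _ _ => rfl⟩
  simp_rw [← hph]
  have hphm : ∀ k, Measurable (ph k) := fun k => by
    have := Finset.measurable_fun_sum (Finset.range k)
      (fun j _ => hg.comp ((hYm j).prodMk (hYm (j + 1))))
    simp only [Function.comp_apply, Function.uncurry_apply_pair] at this
    rw [funext (hph k)]
    fun_prop
  have hph1 : ∀ k ω, ‖ph k ω‖ = 1 := fun k ω => by rw [hph]; exact Complex.norm_exp_ofReal_mul_I _
  have hint : ∀ k, Integrable (fun ω => ph k ω * (w (Y k ω) : ℂ)) P := fun k => by
    refine integrable_of_measurable_of_norm_le (C := 2) ?_ fun ω => ?_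
    · exact (hphm k).mul (Complex.measurable_ofReal.comp (hwm.comp (hYm k)))
    · rw [norm_mul, hph1, one_mul, Complex.norm_real]; exact hw2 _
  -- Given the past, the fluctuation term has mean zero.
  have horth : ∀ k, ∫ ω, ph k ω * m (Y k ω) (Y (k + 1) ω) ∂P = 0 := fun k => by
    simp_rw [hph]
    refine integral_comp_eq_zero_of_indepFun (ν := ν) (C := 3)
      (Z := fun ω => (∑ j ∈ Finset.range k, g (Y j ω) (Y (j + 1) ω), Y k ω)) (V := Y (k + 1))
      (m := fun z y => Complex.exp ((θ * z.1 : ℝ) * Complex.I) * m z.2 y)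
      ?_ (hYm _) (indepFun_chain hY hYm hg k) (hlaw _) ?_ ?_ ?_
    · exact (Finset.measurable_fun_sum _
        fun j _ => hg.comp ((hYm j).prodMk (hYm (j + 1)))).prodMk (hYm k)
    · have h2 : Measurable fun p : (ℝ × S) × S => m p.1.2 p.2 :=
        hmm.comp ((measurable_snd.comp measurable_fst).prodMk measurable_snd)
      simp only [Function.uncurry_def]
      fun_prop
    · intro z y
      rw [norm_mul, Complex.norm_exp_ofReal_mul_I, one_mul]
      exact hmb _ _
    · intro z
      rw [integral_const_mul, hm0, mul_zero]
  have hstep : ∀ k, ‖(∫ ω, ph (k + 1) ω * (w (Y (k + 1) ω) : ℂ) ∂P)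
      - ((1 - r : ℝ) : ℂ) * ∫ ω, ph k ω * (w (Y k ω) : ℂ) ∂P‖ ≤ 8 * u ^ 3 := fun k => by
    have imP : Integrable (fun ω => ph k ω * m (Y k ω) (Y (k + 1) ω)) P := by
      refine integrable_of_measurable_of_norm_le (C := 3) ?_ fun ω => ?_
      · exact (hphm k).mul (hmm.comp ((hYm k).prodMk (hYm (k + 1))))
      · rw [norm_mul, hph1, one_mul]; exact hmb _ _
    have e0 : (∫ ω, ph (k + 1) ω * (w (Y (k + 1) ω) : ℂ) ∂P)
        - ((1 - r : ℝ) : ℂ) * ∫ ω, ph k ω * (w (Y k ω) : ℂ) ∂P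
        = ∫ ω, (ph (k + 1) ω * (w (Y (k + 1) ω) : ℂ)
          - ((1 - r : ℝ) : ℂ) * (ph k ω * (w (Y k ω) : ℂ))
          - ph k ω * m (Y k ω) (Y (k + 1) ω)) ∂P := by
      have i2 := (hint k).const_mul ((1 - r : ℝ) : ℂ)
      rw [integral_sub ?_ imP, integral_sub (hint (k + 1)) i2, horth k,
        sub_zero, integral_const_mul]
      exact (hint (k + 1)).sub i2
    rw [e0]
    refine (norm_integral_le_of_norm_le_const (C := 8 * u ^ 3) (ae_of_all _ fun ω => ?_)).trans_eq
      (by simp)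
    have e1 : |θ * g (Y k ω) (Y (k + 1) ω)| ≤ u := by
      rw [abs_mul]; exact mul_le_mul_of_nonneg_left (hC _ _) (abs_nonneg _)
    have hsucc : ph (k + 1) ω
        = ph k ω * Complex.exp ((θ * g (Y k ω) (Y (k + 1) ω) : ℝ) * Complex.I) := by
      rw [hph, hph, ← Complex.exp_add, Finset.sum_range_succ]
      congr 1; push_cast; ring
    have hexp := norm_exp_mul_I_expansion_le hu0 hθ e1 (hsc (hvI (Y k ω)))
      (hsc (hvI (Y (k + 1) ω))) hrI
    rw [← hwdef, ← hwdef, ← hmdef] at hexp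
    have e2 : ph (k + 1) ω * (w (Y (k + 1) ω) : ℂ)
          - ((1 - r : ℝ) : ℂ) * (ph k ω * (w (Y k ω) : ℂ))
          - ph k ω * m (Y k ω) (Y (k + 1) ω)
        = ph k ω * (Complex.exp ((θ * g (Y k ω) (Y (k + 1) ω) : ℝ) * Complex.I)
          * (w (Y (k + 1) ω) : ℂ) - ((1 - r : ℝ) : ℂ) * (w (Y k ω) : ℂ)
          - m (Y k ω) (Y (k + 1) ω)) := by
      rw [hsucc]; ring
    rw [e2, norm_mul, hph1, one_mul]
    exact hexp
  have hpow : ∀ k : ℕ, ‖(∫ ω, ph k ω * (w (Y k ω) : ℂ) ∂P) - ((1 - r : ℝ) : ℂ) ^ k‖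
      ≤ k * (8 * u ^ 3) := fun k => by
    induction k with
    | zero =>
      have : ∫ ω, w (Y 0 ω) ∂P = 1 := by
        rw [← integral_map (hYm 0).aemeasurable hwm.aestronglyMeasurable, hlaw, hwint]
      simp [hph, integral_complex_ofReal, this]
    | succ k ih =>
      have hr1 : ‖((1 - r : ℝ) : ℂ)‖ ≤ 1 := by
        rw [Complex.norm_real, Real.norm_eq_abs, abs_le]
        constructor <;> linarith [hrI.1, hrI.2]
      calc _ = ‖((∫ ω, ph (k + 1) ω * (w (Y (k + 1) ω) : ℂ) ∂P)
              - ((1 - r : ℝ) : ℂ) * ∫ ω, ph k ω * (w (Y k ω) : ℂ) ∂P)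
              + ((1 - r : ℝ) : ℂ) * ((∫ ω, ph k ω * (w (Y k ω) : ℂ) ∂P)
                - ((1 - r : ℝ) : ℂ) ^ k)‖ := by congr 1; ring
        _ ≤ 8 * u ^ 3 + 1 * (k * (8 * u ^ 3)) := by
          refine (norm_add_le _ _).trans (add_le_add (hstep k) ?_)
          rw [norm_mul]
          gcongr
        _ = _ := by push_cast; ring
  have hlast : ‖(∫ ω, ph k ω ∂P) - ∫ ω, ph k ω * (w (Y k ω) : ℂ) ∂P‖ ≤ u ^ 2 / 2 := by
    rw [← integral_sub (integrable_of_measurable_of_norm_le (hphm k) fun ω => (hph1 k ω).le)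
      (hint k)]
    refine (norm_integral_le_of_norm_le_const (C := u ^ 2 / 2)
      (ae_of_all _ fun ω => ?_)).trans_eq (by simp)
    have : ph k ω - ph k ω * (w (Y k ω) : ℂ) = -(ph k ω * ((w (Y k ω) - 1 : ℝ) : ℂ)) := by
      push_cast; ring
    rw [this, norm_neg, norm_mul, hph1, one_mul, Complex.norm_real]
    exact hw1 _
  calc _ ≤ ‖(∫ ω, ph k ω ∂P) - ∫ ω, ph k ω * (w (Y k ω) : ℂ) ∂P‖
        + ‖(∫ ω, ph k ω * (w (Y k ω) : ℂ) ∂P) - ((1 - r : ℝ) : ℂ) ^ k‖ :=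
        norm_sub_le_norm_sub_add_norm_sub _ _ _
    _ ≤ u ^ 2 / 2 + k * (8 * u ^ 3) := add_le_add hlast (hpow k)
    _ = _ := by ring

/-- Central limit theorem for `∑ g (Y_j) (Y_(j+1))` over an i.i.d. sequence, when `g` is bounded
and centred in its second variable. The sum has `n - 1` terms. -/
theorem tendstoInDistribution_chain {Y : ℕ → Ω → S} (hY : iIndepFun Y P)
    (hYm : ∀ i, Measurable (Y i)) (hlaw : ∀ i, P.map (Y i) = ν)
    {g : S → S → ℝ} (hg : Measurable (Function.uncurry g)) {C : ℝ} (hC : ∀ x y, |g x y| ≤ C)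
    (h0 : ∀ x, ∫ y, g x y ∂ν = 0) :
    TendstoInDistribution
      (fun (n : ℕ) ω => (√(n : ℝ))⁻¹ * ∑ j ∈ Finset.range (n - 1), g (Y j ω) (Y (j + 1) ω))
      atTop (id : ℝ → ℝ) (fun _ => P)
      (gaussianReal 0 (∫ x, condSecondMoment ν g x ∂ν).toNNReal) where
  forall_aemeasurable n := ((Finset.measurable_fun_sum _
    fun j _ => hg.comp ((hYm j).prodMk (hYm (j + 1)))).const_mul _).aemeasurable
  tendsto := by
    refine ProbabilityMeasure.tendsto_iff_tendsto_charFun.2 fun t => ?_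
    have hne : Nonempty S := nonempty_of_isProbabilityMeasure ν
    have hC0 : 0 ≤ C := (abs_nonneg _).trans (hC hne.some hne.some)
    have hs0 := (integral_condSecondMoment_mem_Icc (ν := ν) hg hC).1
    set s := ∫ x, condSecondMoment ν g x ∂ν
    have hmeas : ∀ n : ℕ, Measurable fun ω =>
        (√(n : ℝ))⁻¹ * ∑ j ∈ Finset.range (n - 1), g (Y j ω) (Y (j + 1) ω) := fun n =>
      (Finset.measurable_fun_sum _
        fun j _ => hg.comp ((hYm j).prodMk (hYm (j + 1)))).const_mul _
    have hq : Tendsto (fun n : ℕ => (√(n : ℝ))⁻¹) atTop (nhds 0) :=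
      tendsto_inv_atTop_zero.comp (Real.tendsto_sqrt_atTop.comp tendsto_natCast_atTop_atTop)
    have hlim : Tendsto (fun n : ℕ => ((1 - (t * (√(n : ℝ))⁻¹) ^ 2 / 2 * s : ℝ) : ℂ) ^ (n - 1))
        atTop (nhds (Complex.exp (-(s * t ^ 2 / 2)))) := by
      rw [← tendsto_add_atTop_iff_nat 1]
      have h1 : Tendsto (fun n : ℕ => (n : ℝ) * (-(t ^ 2 / 2 * s) * ((n : ℝ) + 1)⁻¹)) atTop
          (nhds (-(t ^ 2 / 2 * s) * 1)) := by
        refine ((tendsto_natCast_div_add_atTop (1 : ℝ)).const_mul (-(t ^ 2 / 2 * s))).congr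
          fun n => ?_
        ring
      have h2 := (Complex.continuous_ofReal.tendsto _).comp
        (Real.tendsto_one_add_pow_exp_of_tendsto h1)
      have e1 : ((Real.exp (-(t ^ 2 / 2 * s) * 1) : ℝ) : ℂ) = Complex.exp (-(s * t ^ 2 / 2)) := by
        push_cast; congr 1; ring
      rw [e1] at h2
      refine h2.congr fun n => ?_
      have e2 : (√((n + 1 : ℕ) : ℝ))⁻¹ ^ 2 = ((n : ℝ) + 1)⁻¹ := by
        rw [inv_pow, Real.sq_sqrt (by positivity)]; push_cast; rfl
      rw [mul_pow, e2, Function.comp_apply, Nat.add_sub_cancel]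
      push_cast
      congr 1
      ring
    have herr : Tendsto (fun n : ℕ => (n : ℝ) * (8 * (|t * (√(n : ℝ))⁻¹| * C) ^ 3)
        + (|t * (√(n : ℝ))⁻¹| * C) ^ 2 / 2) atTop (nhds 0) := by
      have h1 : Tendsto (fun n : ℕ => 8 * (|t| * C) ^ 3 * (√(n : ℝ))⁻¹
          + (|t| * C) ^ 2 / 2 * (√(n : ℝ))⁻¹ ^ 2) atTop
          (nhds (8 * (|t| * C) ^ 3 * 0 + (|t| * C) ^ 2 / 2 * 0 ^ 2)) :=
        (hq.const_mul _).add ((hq.pow 2).const_mul _)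
      have h2 : 8 * (|t| * C) ^ 3 * 0 + (|t| * C) ^ 2 / 2 * 0 ^ 2 = 0 := by ring
      rw [h2] at h1
      refine h1.congr' ?_
      filter_upwards [eventually_gt_atTop 0] with n hn
      have e1 : (n : ℝ) * (√(n : ℝ))⁻¹ ^ 2 = 1 := by
        rw [inv_pow, Real.sq_sqrt (by positivity)]
        exact mul_inv_cancel₀ (by positivity)
      rw [abs_mul, abs_of_nonneg (by positivity : 0 ≤ (√(n : ℝ))⁻¹)]
      linear_combination (-8 * (|t| * C) ^ 3 * (√(n : ℝ))⁻¹) * e1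
    have hsmall : ∀ᶠ n : ℕ in atTop, |t * (√(n : ℝ))⁻¹| * C ≤ 1 := by
      have h1 : Tendsto (fun n : ℕ => |t * (√(n : ℝ))⁻¹| * C) atTop (nhds (|t * 0| * C)) :=
        ((hq.const_mul t).abs).mul_const C
      rw [mul_zero, abs_zero, zero_mul] at h1
      exact (h1.eventually_lt_const one_pos).mono fun n hn => hn.le
    have hdiff : Tendsto (fun n : ℕ =>
        charFun (P.map fun ω =>
          (√(n : ℝ))⁻¹ * ∑ j ∈ Finset.range (n - 1), g (Y j ω) (Y (j + 1) ω)) t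
        - ((1 - (t * (√(n : ℝ))⁻¹) ^ 2 / 2 * s : ℝ) : ℂ) ^ (n - 1)) atTop (nhds 0) := by
      refine squeeze_zero_norm' ?_ herr
      filter_upwards [hsmall] with n hn
      rw [charFun_apply_real, integral_map (hmeas n).aemeasurable
        (by fun_prop : Measurable fun x : ℝ => Complex.exp (t * x * Complex.I)).aestronglyMeasurable]
      have h := norm_integral_exp_chain_sub_pow_le hY hYm hlaw hg hC h0 hn (n - 1)
      refine le_trans (le_of_eq ?_) (h.trans ?_)
      · congr 3
        ext ω
        congr 2
        push_cast; ring
      · have : ((n - 1 : ℕ) : ℝ) ≤ n := by exact_mod_cast Nat.sub_le n 1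
        gcongr
    have := hdiff.add hlim
    simp only [sub_add_cancel, zero_add] at this
    simp only [ProbabilityMeasure.coe_mk, Measure.map_id, charFun_gaussianReal]
    convert this using 2
    simp [Real.coe_toNNReal _ hs0]

end Chain

/-! ### Hoeffding decomposition and second moment bounds -/

section InMeasure

variable {Ω : Type*} [MeasurableSpace Ω] {P : Measure Ω}

lemma tendstoInMeasure_add {X Y : ℕ → Ω → ℝ} {a b : Ω → ℝ} (hX : TendstoInMeasure P X atTop a)
    (hY : TendstoInMeasure P Y atTop b) :
    TendstoInMeasure P (fun n ω => X n ω + Y n ω) atTop (fun ω => a ω + b ω) := by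
  rw [tendstoInMeasure_iff_norm] at *
  intro ε hε
  have h := (hX (ε / 2) (half_pos hε)).add (hY (ε / 2) (half_pos hε))
  rw [add_zero] at h
  refine tendsto_of_tendsto_of_tendsto_of_le_of_le tendsto_const_nhds h (fun _ => zero_le)
    fun n => (measure_mono ?_).trans (measure_union_le _ _)
  intro ω hω
  simp only [Set.mem_ofPred_eq, Set.mem_union, Real.norm_eq_abs] at *
  by_contra! hcon
  have h1 := abs_add_le (X n ω - a ω) (Y n ω - b ω)
  have h2 : X n ω + Y n ω - (a ω + b ω) = X n ω - a ω + (Y n ω - b ω) := by ring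
  rw [h2] at hω
  linarith [hcon.1, hcon.2]

lemma tendstoInMeasure_zero_of_integral_sq_le [IsFiniteMeasure P] {X : ℕ → Ω → ℝ}
    (hX : ∀ n, Integrable (fun ω => X n ω ^ 2) P) {b : ℕ → ℝ}
    (hb : ∀ n, ∫ ω, X n ω ^ 2 ∂P ≤ b n) (hb0 : Tendsto b atTop (nhds 0)) :
    TendstoInMeasure P X atTop 0 := by
  rw [tendstoInMeasure_iff_measureReal_norm]
  intro ε hε
  have h := hb0.div_const (ε ^ 2)
  rw [zero_div] at h
  refine squeeze_zero (fun _ => measureReal_nonneg) (fun n => ?_) h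
  have h1 := mul_meas_ge_le_integral_of_nonneg (ae_of_all P fun ω => sq_nonneg (X n ω)) (hX n)
    (ε ^ 2)
  have h2 : {ω | ε ≤ ‖X n ω - (0 : Ω → ℝ) ω‖} ⊆ {ω | ε ^ 2 ≤ X n ω ^ 2} := fun ω hω => by
    simp only [Set.mem_ofPred_eq, Pi.zero_apply, sub_zero, Real.norm_eq_abs] at *
    rw [← sq_abs (X n ω)]
    gcongr
  rw [le_div_iff₀ (by positivity), mul_comm]
  exact (mul_le_mul_of_nonneg_left (measureReal_mono h2) (by positivity)).trans (h1.trans (hb n))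

lemma tendstoInMeasure_zero_of_abs_le {X : ℕ → Ω → ℝ} {b : ℕ → ℝ} (hX : ∀ n ω, |X n ω| ≤ b n)
    (hb0 : Tendsto b atTop (nhds 0)) : TendstoInMeasure P X atTop 0 := by
  rw [tendstoInMeasure_iff_norm]
  intro ε hε
  refine tendsto_const_nhds.congr' ?_
  filter_upwards [hb0.eventually_lt_const hε] with n hn
  have : {ω | ε ≤ ‖X n ω - (0 : Ω → ℝ) ω‖} = ∅ := by
    ext ω
    simpa using (hX n ω).trans_lt hn
  rw [this, measure_empty]

end InMeasure

section Hoeffding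

variable {Ω S : Type*} [MeasurableSpace Ω] [MeasurableSpace S]
  {P : Measure Ω} [IsProbabilityMeasure P] {ν : Measure S} [IsProbabilityMeasure ν]

/-- The first Hoeffding projection `x ↦ ∫ H x y ∂ν y`. -/
noncomputable def kernelProj (ν : Measure S) (H : S → S → ℝ) (x : S) : ℝ := ∫ y, H x y ∂ν

/-- The mean `∫∫ H x y ∂ν y ∂ν x` of the kernel. -/
noncomputable def kernelMean (ν : Measure S) (H : S → S → ℝ) : ℝ := ∫ x, kernelProj ν H x ∂ν

/-- The completely degenerate part of a symmetric kernel in its Hoeffding decomposition. -/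
noncomputable def degeneratePart (ν : Measure S) (H : S → S → ℝ) (x y : S) : ℝ :=
  H x y - kernelProj ν H x - kernelProj ν H y + kernelMean ν H

variable {H : S → S → ℝ} {C : ℝ}

lemma measurable_kernelProj (hH : Measurable (Function.uncurry H)) : Measurable (kernelProj ν H) :=
  (hH.stronglyMeasurable.integral_prod_right (ν := ν)).measurable

lemma abs_kernelProj_le (hC : ∀ x y, |H x y| ≤ C) (x : S) : |kernelProj ν H x| ≤ C := by
  simpa [kernelProj] using norm_integral_le_of_norm_le_const (μ := ν) (f := H x) (C := C)
    (ae_of_all _ (hC x))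

lemma abs_kernelMean_le (hC : ∀ x y, |H x y| ≤ C) : |kernelMean ν H| ≤ C := by
  simpa [kernelMean] using
    norm_integral_le_of_norm_le_const (μ := ν) (f := kernelProj ν H) (C := C)
      (ae_of_all _ (abs_kernelProj_le (ν := ν) hC))

lemma integrable_kernelProj (hH : Measurable (Function.uncurry H)) (hC : ∀ x y, |H x y| ≤ C) :
    Integrable (kernelProj ν H) ν :=
  integrable_of_measurable_of_norm_le (measurable_kernelProj hH) (abs_kernelProj_le hC)

lemma measurable_degeneratePart (hH : Measurable (Function.uncurry H)) :
    Measurable (Function.uncurry (degeneratePart ν H)) := by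
  have h1 : Measurable fun p : S × S => H p.1 p.2 := hH
  have h2 := measurable_kernelProj (ν := ν) hH
  unfold degeneratePart
  simp only [Function.uncurry_def]
  fun_prop

lemma abs_degeneratePart_le (hC : ∀ x y, |H x y| ≤ C) (x y : S) :
    |degeneratePart ν H x y| ≤ 4 * C := by
  have h1 := abs_le.1 (hC x y)
  have h2 := abs_le.1 (abs_kernelProj_le (ν := ν) hC x)
  have h3 := abs_le.1 (abs_kernelProj_le (ν := ν) hC y)
  have h4 := abs_le.1 (abs_kernelMean_le (ν := ν) hC)
  unfold degeneratePart
  rw [abs_le]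
  constructor <;> linarith [h1.1, h1.2, h2.1, h2.2, h3.1, h3.2, h4.1, h4.2]

omit [IsProbabilityMeasure ν] in
lemma degeneratePart_comm (hs : ∀ x y, H x y = H y x) (x y : S) :
    degeneratePart ν H x y = degeneratePart ν H y x := by
  unfold degeneratePart
  rw [hs x y]; ring

lemma integral_degeneratePart (hH : Measurable (Function.uncurry H)) (hC : ∀ x y, |H x y| ≤ C)
    (x : S) : ∫ y, degeneratePart ν H x y ∂ν = 0 := by
  have i1 : Integrable (fun y => H x y) ν :=
    integrable_of_measurable_of_norm_le hH.of_uncurry_left (hC x)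
  have i2 := integrable_kernelProj (ν := ν) hH hC
  have e : ∀ y, degeneratePart ν H x y
      = (H x y - kernelProj ν H y) + (kernelMean ν H - kernelProj ν H x) := fun y => by
    unfold degeneratePart; ring
  simp_rw [e]
  rw [integral_add ?_ (integrable_const _), integral_sub i1 i2]
  · simp [kernelProj, kernelMean]
  · exact i1.sub i2

/-- An index that occurs only once makes the product moment of a degenerate kernel vanish. -/
lemma integral_mul_eq_zero_of_unpaired {Y : ℕ → Ω → S} (hY : iIndepFun Y P)
    (hYm : ∀ i, Measurable (Y i)) (hlaw : ∀ i, P.map (Y i) = ν)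
    {g : S → S → ℝ} (hg : Measurable (Function.uncurry g)) (hs : ∀ x y, g x y = g y x)
    (hC : ∀ x y, |g x y| ≤ C) (h0 : ∀ x, ∫ y, g x y ∂ν = 0) {i j k l : ℕ}
    (hij : i ≠ j) (hik : i ≠ k) (hil : i ≠ l) :
    ∫ ω, g (Y i ω) (Y j ω) * g (Y k ω) (Y l ω) ∂P = 0 := by
  have hind : IndepFun (fun ω => (Y j ω, Y k ω, Y l ω)) (Y i) P := by
    have hφ : Measurable fun z : ({j, k, l} : Finset ℕ) → S =>
        (z ⟨j, by simp⟩, z ⟨k, by simp⟩, z ⟨l, by simp⟩) :=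
      (measurable_pi_apply _).prodMk ((measurable_pi_apply _).prodMk (measurable_pi_apply _))
    exact (indepFun_restrict_of_notMem hY hYm (s := {j, k, l}) (j := i)
      (by simp [hij, hik, hil])).comp hφ measurable_id
  have hprod : ∀ a b c d, |g a b * g c d| ≤ C * C := fun a b c d => by
    rw [abs_mul]
    exact mul_le_mul (hC _ _) (hC _ _) (abs_nonneg _) ((abs_nonneg _).trans (hC a b))
  refine integral_comp_eq_zero_of_indepFun (ν := ν) (C := C * C)
    (Z := fun ω => (Y j ω, Y k ω, Y l ω)) (V := Y i)
    (m := fun z y => g y z.1 * g z.2.1 z.2.2)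
    ((hYm j).prodMk ((hYm k).prodMk (hYm l))) (hYm i) hind (hlaw i) ?_ (fun z y => hprod _ _ _ _) ?_
  · have h1 : Measurable fun p : S × S => g p.1 p.2 := hg
    have h2 : Measurable fun p : (S × S × S) × S => g p.2 p.1.1 :=
      h1.comp (measurable_snd.prodMk (measurable_fst.comp measurable_fst))
    have h3 : Measurable fun p : (S × S × S) × S => g p.1.2.1 p.1.2.2 :=
      h1.comp (measurable_snd.comp measurable_fst)
    exact h2.mul h3
  · intro z
    simp_rw [fun y => hs y z.1]
    rw [integral_mul_const, h0, zero_mul]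

/-- The second moment of a degenerate double sum is `O(n²)`, not `O(n⁴)`: a quadruple of indices
`i, j, k, l` contributes only if `i = j ∧ k = l`, or `(i, j) = (k, l)`, or `(i, j) = (l, k)`. -/
lemma integral_sq_double_sum_le {Y : ℕ → Ω → S} (hY : iIndepFun Y P)
    (hYm : ∀ i, Measurable (Y i)) (hlaw : ∀ i, P.map (Y i) = ν)
    {g : S → S → ℝ} (hg : Measurable (Function.uncurry g)) (hs : ∀ x y, g x y = g y x)
    (hC : ∀ x y, |g x y| ≤ C) (h0 : ∀ x, ∫ y, g x y ∂ν = 0) (n : ℕ) :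
    ∫ ω, (∑ i ∈ Finset.range n, ∑ j ∈ Finset.range n, g (Y i ω) (Y j ω)) ^ 2 ∂P
      ≤ 3 * C ^ 2 * n ^ 2 := by
  set I := Finset.range n ×ˢ Finset.range n with hI
  have hgm : ∀ p : ℕ × ℕ, Measurable fun ω => g (Y p.1 ω) (Y p.2 ω) := fun p =>
    hg.comp ((hYm p.1).prodMk (hYm p.2))
  have hprod : ∀ a b c d, |g a b * g c d| ≤ C ^ 2 := fun a b c d => by
    rw [abs_mul, sq]
    exact mul_le_mul (hC _ _) (hC _ _) (abs_nonneg _) ((abs_nonneg _).trans (hC a b))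
  have hint : ∀ p q : ℕ × ℕ,
      Integrable (fun ω => g (Y p.1 ω) (Y p.2 ω) * g (Y q.1 ω) (Y q.2 ω)) P := fun p q =>
    integrable_of_measurable_of_norm_le ((hgm p).mul (hgm q)) fun ω => hprod _ _ _ _
  have hterm : ∀ p q : ℕ × ℕ, ∫ ω, g (Y p.1 ω) (Y p.2 ω) * g (Y q.1 ω) (Y q.2 ω) ∂P
      ≤ C ^ 2 * ((if p.1 = p.2 then 1 else 0) * (if q.1 = q.2 then 1 else 0)
        + (if p = q then 1 else 0) + (if p.swap = q then 1 else 0)) := by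
    rintro ⟨i, j⟩ ⟨k, l⟩
    have hb : ∫ ω, g (Y i ω) (Y j ω) * g (Y k ω) (Y l ω) ∂P ≤ C ^ 2 := by
      have := norm_integral_le_of_norm_le_const (μ := P) (C := C ^ 2)
        (f := fun ω => g (Y i ω) (Y j ω) * g (Y k ω) (Y l ω))
        (ae_of_all _ fun ω => hprod (Y i ω) (Y j ω) (Y k ω) (Y l ω))
      exact (le_abs_self _).trans (by simpa using this)
    have hz := fun {a b c d : ℕ} => integral_mul_eq_zero_of_unpaired (P := P) hY hYm hlaw hg hs hC
      h0 (i := a) (j := b) (k := c) (l := d)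
    have hC2 := sq_nonneg C
    simp only [Prod.swap_prod_mk, Prod.mk.injEq]
    by_cases hpair : (i = j ∧ k = l) ∨ (i = k ∧ j = l) ∨ (j = k ∧ i = l)
    · refine hb.trans ?_
      rcases hpair with h | h | h
      all_goals
        simp only [h.1, h.2, and_self, if_true]
        split_ifs <;> nlinarith
    · have : ∫ ω, g (Y i ω) (Y j ω) * g (Y k ω) (Y l ω) ∂P = 0 := by
        by_cases hi : i ≠ j ∧ i ≠ k ∧ i ≠ l
        · exact hz hi.1 hi.2.1 hi.2.2
        by_cases hj : j ≠ i ∧ j ≠ k ∧ j ≠ l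
        · simp_rw [fun ω => hs (Y i ω) (Y j ω)]
          exact hz hj.1 hj.2.1 hj.2.2
        by_cases hk : k ≠ l ∧ k ≠ i ∧ k ≠ j
        · simp_rw [fun ω => mul_comm (g (Y i ω) (Y j ω)) (g (Y k ω) (Y l ω))]
          exact hz hk.1 hk.2.1 hk.2.2
        have hl : l ≠ k ∧ l ≠ i ∧ l ≠ j := by omega
        simp_rw [fun ω => mul_comm (g (Y i ω) (Y j ω)) (g (Y k ω) (Y l ω)),
          fun ω => hs (Y k ω) (Y l ω)]
        exact hz hl.1 hl.2.1 hl.2.2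
      rw [this]
      positivity
  have hsum : ∀ ω, (∑ i ∈ Finset.range n, ∑ j ∈ Finset.range n, g (Y i ω) (Y j ω)) ^ 2
      = ∑ p ∈ I, ∑ q ∈ I, g (Y p.1 ω) (Y p.2 ω) * g (Y q.1 ω) (Y q.2 ω) := fun ω => by
    rw [← Finset.sum_product', sq, Finset.sum_mul_sum]
  simp_rw [hsum]
  rw [integral_finsetSum _ fun p _ => integrable_finsetSum _ fun q _ => hint p q]
  simp_rw [fun p : ℕ × ℕ => integral_finsetSum I fun q _ => hint p q]
  refine (Finset.sum_le_sum fun p _ => Finset.sum_le_sum fun q _ => hterm p q).trans ?_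
  have hd : ∑ p ∈ I, (if p.1 = p.2 then (1 : ℝ) else 0) = n := by
    rw [hI, Finset.sum_product]
    simp_rw [Finset.sum_ite_eq]
    rw [Finset.sum_congr rfl fun i hi => if_pos hi]
    simp
  have hcard : ∑ p ∈ I, (1 : ℝ) = n ^ 2 := by
    simp [hI, sq]
  have h1 : ∑ p ∈ I, ∑ q ∈ I, (if p = q then (1 : ℝ) else 0) ≤ n ^ 2 := by
    rw [← hcard]
    refine Finset.sum_le_sum fun p _ => ?_
    rw [Finset.sum_ite_eq]
    split_ifs
    all_goals norm_num
  have h2 : ∑ p ∈ I, ∑ q ∈ I, (if p.swap = q then (1 : ℝ) else 0) ≤ n ^ 2 := by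
    rw [← hcard]
    refine Finset.sum_le_sum fun p _ => ?_
    rw [Finset.sum_ite_eq]
    split_ifs
    all_goals norm_num
  simp_rw [← Finset.mul_sum, Finset.sum_add_distrib, ← Finset.sum_mul_sum, hd]
  nlinarith [sq_nonneg C, mul_le_mul_of_nonneg_left h1 (sq_nonneg C),
    mul_le_mul_of_nonneg_left h2 (sq_nonneg C)]

/-- The V-statistic `n⁻² ∑_{i<n} ∑_{j<n} H (y i) (y j)` of a sequence. -/
noncomputable def pairMean (H : S → S → ℝ) (n : ℕ) (y : ℕ → S) : ℝ :=
  1 / (n : ℝ) ^ 2 * ∑ i ∈ Finset.range n, ∑ j ∈ Finset.range n, H (y i) (y j)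

/-- The normalized variation `n⁻¹ ∑_{i<n-1} H (y i) (y (i+1))` along the first `n` terms of a
sequence. -/
noncomputable def stepMean (H : S → S → ℝ) (n : ℕ) (y : ℕ → S) : ℝ :=
  1 / (n : ℝ) * ∑ i ∈ Finset.range (n - 1), H (y i) (y (i + 1))

omit [IsProbabilityMeasure ν] in
lemma pairMean_eq (H : S → S → ℝ) {n : ℕ} (hn : n ≠ 0) (y : ℕ → S) :
    pairMean H n y = pairMean (degeneratePart ν H) n y
      + (2 * ((∑ i ∈ Finset.range n, kernelProj ν H (y i)) / n) - kernelMean ν H) := by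
  have hn' : (n : ℝ) ≠ 0 := by exact_mod_cast hn
  have e : ∀ x z, H x z = degeneratePart ν H x z + kernelProj ν H x + kernelProj ν H z
      - kernelMean ν H := fun x z => by unfold degeneratePart; ring
  have : ∑ i ∈ Finset.range n, ∑ j ∈ Finset.range n, H (y i) (y j)
      = ∑ i ∈ Finset.range n, ∑ j ∈ Finset.range n, degeneratePart ν H (y i) (y j)
        + 2 * n * ∑ i ∈ Finset.range n, kernelProj ν H (y i) - n ^ 2 * kernelMean ν H := by
    simp_rw [fun i j => e (y i) (y j), Finset.sum_sub_distrib, Finset.sum_add_distrib]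
    simp only [Finset.sum_const, Finset.card_range, nsmul_eq_mul, ← Finset.mul_sum]
    ring
  unfold pairMean
  rw [this]
  field_simp
  ring

omit [IsProbabilityMeasure ν] in
/-- The projections cancel in the difference of the two statistics, except for the first and the
last observation, which have only one neighbour. -/
lemma sqrt_mul_pairMean_sub_stepMean (H : S → S → ℝ) {n : ℕ} (hn : n ≠ 0) (y : ℕ → S) :
    √(n : ℝ) * (pairMean H n y - stepMean H n y)
      = -((√(n : ℝ))⁻¹ * ∑ i ∈ Finset.range (n - 1), degeneratePart ν H (y i) (y (i + 1)))
        + (√(n : ℝ) * pairMean (degeneratePart ν H) n y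
          + (√(n : ℝ))⁻¹ * (kernelProj ν H (y 0) + kernelProj ν H (y (n - 1))
            - kernelMean ν H)) := by
  rw [pairMean_eq (ν := ν) H hn y]
  obtain ⟨k, rfl⟩ := Nat.exists_eq_succ_of_ne_zero hn
  simp only [Nat.succ_eq_add_one, Nat.add_sub_cancel]
  have e : ∀ x z, H x z = degeneratePart ν H x z + kernelProj ν H x + kernelProj ν H z
      - kernelMean ν H := fun x z => by unfold degeneratePart; ring
  have h1 := Finset.sum_range_succ (fun i => kernelProj ν H (y i)) k
  have h2 := Finset.sum_range_succ' (fun i => kernelProj ν H (y i)) k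
  have hstep : stepMean H (k + 1) y = 1 / ((k : ℝ) + 1)
      * (∑ i ∈ Finset.range k, degeneratePart ν H (y i) (y (i + 1))
        + 2 * ∑ i ∈ Finset.range (k + 1), kernelProj ν H (y i)
        - kernelProj ν H (y 0) - kernelProj ν H (y k) - k * kernelMean ν H) := by
    unfold stepMean
    simp_rw [fun i => e (y i) (y (i + 1)), Nat.add_sub_cancel, Finset.sum_sub_distrib,
      Finset.sum_add_distrib]
    simp only [Finset.sum_const, Finset.card_range, nsmul_eq_mul]
    push_cast
    congr 1
    linarith
  rw [hstep]
  push_cast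
  have hk : (0 : ℝ) < (k : ℝ) + 1 := by positivity
  have hs : (√((k : ℝ) + 1))⁻¹ = √((k : ℝ) + 1) * (1 / ((k : ℝ) + 1)) := by
    rw [mul_one_div, Real.sqrt_div_self', one_div]
  rw [hs]
  field_simp
  ring

lemma tendstoInMeasure_pairMean {Y : ℕ → Ω → S} (hY : iIndepFun Y P)
    (hYm : ∀ i, Measurable (Y i)) (hlaw : ∀ i, P.map (Y i) = ν)
    (hH : Measurable (Function.uncurry H)) (hs : ∀ x y, H x y = H y x)
    (hC : ∀ x y, |H x y| ≤ C) :
    TendstoInMeasure P (fun (n : ℕ) ω => √(n : ℝ) * pairMean (degeneratePart ν H) n fun i => Y i ω)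
        atTop 0
      ∧ TendstoInMeasure P (fun n ω => pairMean H n fun i => Y i ω) atTop
        fun _ => kernelMean ν H := by
  have hgm := measurable_degeneratePart (ν := ν) hH
  have hgC := abs_degeneratePart_le (ν := ν) hC
  have hsq := integral_sq_double_sum_le hY hYm hlaw hgm (degeneratePart_comm hs) hgC
    (integral_degeneratePart hH hC)
  have hDm : ∀ n, Measurable fun ω =>
      ∑ i ∈ Finset.range n, ∑ j ∈ Finset.range n, degeneratePart ν H (Y i ω) (Y j ω) := fun n =>
    Finset.measurable_fun_sum _ fun i _ => Finset.measurable_fun_sum _ fun j _ =>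
      hgm.comp ((hYm i).prodMk (hYm j))
  have hDb : ∀ n ω, |∑ i ∈ Finset.range n, ∑ j ∈ Finset.range n,
      degeneratePart ν H (Y i ω) (Y j ω)| ≤ n * (n * (4 * C)) := fun n ω => by
    refine (Finset.abs_sum_le_sum_abs _ _).trans ?_
    refine (Finset.sum_le_card_nsmul _ _ (n * (4 * C)) fun i _ => ?_).trans (by simp)
    refine (Finset.abs_sum_le_sum_abs _ _).trans ?_
    exact (Finset.sum_le_card_nsmul _ _ (4 * C) fun j _ => hgC _ _).trans (by simp)
  have hDint : ∀ n, Integrable (fun ω =>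
      (∑ i ∈ Finset.range n, ∑ j ∈ Finset.range n, degeneratePart ν H (Y i ω) (Y j ω)) ^ 2) P :=
    fun n => integrable_of_measurable_of_norm_le ((hDm n).pow_const 2)
      (C := (n * (n * (4 * C))) ^ 2) fun ω => by
        rw [norm_pow]; exact pow_le_pow_left₀ (norm_nonneg _) (hDb n ω) 2
  have hinv : Tendsto (fun n : ℕ => 3 * (4 * C) ^ 2 * ((n : ℝ))⁻¹) atTop (nhds 0) := by
    simpa using (tendsto_inv_atTop_zero.comp tendsto_natCast_atTop_atTop :
      Tendsto (fun n : ℕ => ((n : ℝ))⁻¹) atTop (nhds 0)).const_mul (3 * (4 * C) ^ 2)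
  have hfirst : TendstoInMeasure P
      (fun (n : ℕ) ω => √(n : ℝ) * pairMean (degeneratePart ν H) n fun i => Y i ω) atTop 0 := by
    have e : ∀ (n : ℕ) ω, (√(n : ℝ) * pairMean (degeneratePart ν H) n fun i => Y i ω) ^ 2
        = (n : ℝ) * (1 / (n : ℝ) ^ 2) ^ 2 * (∑ i ∈ Finset.range n, ∑ j ∈ Finset.range n,
          degeneratePart ν H (Y i ω) (Y j ω)) ^ 2 := fun n ω => by
      rw [mul_pow, Real.sq_sqrt (by positivity), pairMean, mul_pow, mul_assoc]
    refine tendstoInMeasure_zero_of_integral_sq_le (fun n => ?_) (fun n => ?_) hinv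
    · simp_rw [e]
      exact (hDint n).const_mul _
    · simp_rw [e]
      rw [integral_const_mul]
      rcases eq_or_ne n 0 with rfl | hn
      · simp
      · have hn' : (0 : ℝ) < n := by positivity
        calc _ ≤ (n : ℝ) * (1 / (n : ℝ) ^ 2) ^ 2 * (3 * (4 * C) ^ 2 * n ^ 2) :=
              mul_le_mul_of_nonneg_left (hsq n) (by positivity)
          _ = _ := by field_simp
  refine ⟨hfirst, ?_⟩
  have hpm := measurable_kernelProj (ν := ν) hH
  have hpair : TendstoInMeasure P
      (fun n ω => pairMean (degeneratePart ν H) n fun i => Y i ω) atTop 0 := by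
    rw [tendstoInMeasure_iff_norm] at hfirst ⊢
    intro ε hε
    refine tendsto_of_tendsto_of_tendsto_of_le_of_le' tendsto_const_nhds (hfirst ε hε)
      (Eventually.of_forall fun _ => zero_le) ?_
    filter_upwards [eventually_ge_atTop 1] with n hn
    refine measure_mono fun ω hω => ?_
    simp only [Set.mem_ofPred_eq, Pi.zero_apply, sub_zero, norm_mul] at *
    have h1 : 1 ≤ ‖√(n : ℝ)‖ := by
      rw [Real.norm_eq_abs, abs_of_nonneg (Real.sqrt_nonneg _)]
      exact Real.one_le_sqrt.2 (by exact_mod_cast hn)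
    exact hω.trans (le_mul_of_one_le_left (norm_nonneg _) h1)
  have hlln : TendstoInMeasure P (fun (n : ℕ) ω =>
      2 * ((∑ i ∈ Finset.range n, kernelProj ν H (Y i ω)) / n) - kernelMean ν H) atTop
      fun _ => kernelMean ν H := by
    refine tendstoInMeasure_of_tendsto_ae (fun n => ?_) ?_
    · exact ((((Finset.measurable_fun_sum _ fun i _ => hpm.comp (hYm i)).div_const _).const_mul
        2).sub_const _).aestronglyMeasurable
    · have hlawp : ∀ i, IdentDistrib (fun ω => kernelProj ν H (Y i ω))
          (fun ω => kernelProj ν H (Y 0 ω)) P P := fun i =>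
        (IdentDistrib.mk (hYm i).aemeasurable (hYm 0).aemeasurable
          ((hlaw i).trans (hlaw 0).symm)).comp hpm
      have hsl := strong_law_ae_real (μ := P) (fun i ω => kernelProj ν H (Y i ω))
        (integrable_of_measurable_of_norm_le (hpm.comp (hYm 0)) fun ω => abs_kernelProj_le hC _)
        (fun i j hij => (hY.indepFun hij).comp hpm hpm) hlawp
      have hE : ∫ ω, kernelProj ν H (Y 0 ω) ∂P = kernelMean ν H := by
        rw [← integral_map (hYm 0).aemeasurable hpm.aestronglyMeasurable, hlaw]; rfl
      filter_upwards [hsl] with ω hω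
      rw [hE] at hω
      have := (hω.const_mul 2).sub_const (kernelMean ν H)
      convert this using 2
      ring
  have hadd := tendstoInMeasure_add hpair hlln
  refine hadd.congr' ?_ (Eventually.of_forall fun ω => by simp)
  filter_upwards [eventually_ne_atTop 0] with n hn
  exact Eventually.of_forall fun ω => (pairMean_eq H hn _).symm

end Hoeffding

/-! ### Slutsky argument, variance formula and positivity -/

section Slutsky

variable {Ω S : Type*} [MeasurableSpace Ω] [MeasurableSpace S]
  {P : Measure Ω} [IsProbabilityMeasure P] {ν : Measure S} [IsProbabilityMeasure ν]
  {H : S → S → ℝ} {C : ℝ} {Y : ℕ → Ω → S}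

lemma measurable_pairMean (hYm : ∀ i, Measurable (Y i)) (hH : Measurable (Function.uncurry H))
    (n : ℕ) : Measurable fun ω => pairMean H n fun i => Y i ω :=
  (Finset.measurable_fun_sum _ fun i _ => Finset.measurable_fun_sum _ fun j _ =>
    hH.comp ((hYm i).prodMk (hYm j))).const_mul _

/-- Asymptotic normality of `√n (1 - ζ_n / χ_n)` for an i.i.d. sequence in its given order. The
value of the statistic on the event `χ_n = 0` is arbitrary, since the probability of that event
tends to zero. -/
theorem tendstoInDistribution_sqrt_mul_one_sub_div (hY : iIndepFun Y P)
    (hYm : ∀ i, Measurable (Y i)) (hlaw : ∀ i, P.map (Y i) = ν)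
    (hH : Measurable (Function.uncurry H)) (hs : ∀ x y, H x y = H y x)
    (hC : ∀ x y, |H x y| ≤ C) (hμ : 0 < kernelMean ν H)
    {X : ℕ → Ω → ℝ} (hXm : ∀ n, Measurable (X n))
    (hX : ∀ n ω, pairMean H n (fun i => Y i ω) ≠ 0 → X n ω
      = √(n : ℝ) * (1 - stepMean H n (fun i => Y i ω) / pairMean H n (fun i => Y i ω))) :
    TendstoInDistribution X atTop (id : ℝ → ℝ) (fun _ => P)
      (gaussianReal 0 ((∫ x, condSecondMoment ν (degeneratePart ν H) x ∂ν)
        / kernelMean ν H ^ 2).toNNReal) := by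
  set μ := kernelMean ν H with hμdef
  have hgm := measurable_degeneratePart (ν := ν) hH
  have hpm := measurable_kernelProj (ν := ν) hH
  obtain ⟨hR1, hχ⟩ := tendstoInMeasure_pairMean hY hYm hlaw hH hs hC
  have hχm := measurable_pairMean (Y := Y) hYm hH
  have hclt := tendstoInDistribution_chain hY hYm hlaw
    (g := fun x y => -(degeneratePart ν H x y) / μ) (hgm.neg.div_const μ) (C := 4 * C / μ)
    (fun x y => by
      rw [abs_div, abs_neg, abs_of_pos hμ]
      gcongr
      exact abs_degeneratePart_le hC x y)
    (fun x => by
      rw [integral_div, integral_neg, integral_degeneratePart hH hC]; simp)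
  -- Dividing by `μ` before taking the limit makes the limit law the asserted one.
  have hvar : ∫ x, condSecondMoment ν (fun x y => -(degeneratePart ν H x y) / μ) x ∂ν
      = (∫ x, condSecondMoment ν (degeneratePart ν H) x ∂ν) / μ ^ 2 := by
    simp_rw [condSecondMoment, div_pow, neg_sq, integral_div]
  rw [hvar] at hclt
  have hR2 : TendstoInMeasure P (fun (n : ℕ) ω => (√(n : ℝ))⁻¹
      * (kernelProj ν H (Y 0 ω) + kernelProj ν H (Y (n - 1) ω) - kernelMean ν H)) atTop 0 := by
    refine tendstoInMeasure_zero_of_abs_le (b := fun n : ℕ => (√(n : ℝ))⁻¹ * (3 * C))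
      (fun n ω => ?_) ?_
    · rw [abs_mul, abs_of_nonneg (by positivity : 0 ≤ (√(n : ℝ))⁻¹)]
      gcongr
      have h1 := abs_le.1 (abs_kernelProj_le (ν := ν) hC (Y 0 ω))
      have h2 := abs_le.1 (abs_kernelProj_le (ν := ν) hC (Y (n - 1) ω))
      have h3 := abs_le.1 (abs_kernelMean_le (ν := ν) hC)
      rw [abs_le]
      constructor <;> linarith [h1.1, h1.2, h2.1, h2.2, h3.1, h3.2]
    · have hq : Tendsto (fun n : ℕ => (√(n : ℝ))⁻¹) atTop (nhds 0) :=
        tendsto_inv_atTop_zero.comp (Real.tendsto_sqrt_atTop.comp tendsto_natCast_atTop_atTop)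
      simpa using hq.mul_const (3 * C)
  have hR := tendstoInMeasure_add hR1 hR2
  have hR' := hR.congr_right (g' := fun _ => (0 : ℝ)) (Eventually.of_forall fun ω => by simp)
  have hRm : ∀ n : ℕ, AEMeasurable (fun ω =>
      (√(n : ℝ) * pairMean (degeneratePart ν H) n fun i => Y i ω) + (√(n : ℝ))⁻¹
      * (kernelProj ν H (Y 0 ω) + kernelProj ν H (Y (n - 1) ω) - kernelMean ν H)) P := fun n => by
    have h1 := measurable_pairMean (Y := Y) hYm hgm n
    have h2 := hpm.comp (hYm 0)
    have h3 := hpm.comp (hYm (n - 1))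
    exact ((h1.const_mul _).add (((h2.add h3).sub_const _).const_mul _)).aemeasurable
  have hV := hclt.continuous_comp_prodMk_of_tendstoInMeasure_const
    (g := fun x : ℝ × ℝ => x.1 + x.2 / μ) (by fun_prop) hR' hRm
  -- The truncation `max χ_n (μ / 2)` makes the division continuous; it is inactive with
  -- probability tending to one.
  have hmax : ∀ c : ℝ, max c (μ / 2) ≠ 0 := fun c =>
    ((half_pos hμ).trans_le (le_max_right _ _)).ne'
  have hW := hV.continuous_comp_prodMk_of_tendstoInMeasure_const
    (g := fun x : ℝ × ℝ => x.1 * (μ * (max x.2 (μ / 2))⁻¹)) ?_ hχ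
    (fun n => (hχm n).aemeasurable)
  swap
  · exact continuous_fst.mul (continuous_const.mul
      ((continuous_snd.max continuous_const).inv₀ fun x => hmax x.2))
  have hW' := hW.congr (T := (id : ℝ → ℝ)) (fun n => EventuallyEq.rfl)
    (Eventually.of_forall fun x => by
      have : max μ (μ / 2) = μ := max_eq_left (by linarith)
      simp [← hμdef, this, mul_inv_cancel₀ hμ.ne'])
  refine tendstoInDistribution_of_tendstoInMeasure_sub X _ hW' ?_ fun n => (hXm n).aemeasurable
  rw [tendstoInMeasure_iff_norm] at hχ ⊢
  intro ε hε
  refine tendsto_of_tendsto_of_tendsto_of_le_of_le' tendsto_const_nhds (hχ (μ / 2) (half_pos hμ))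
    (Eventually.of_forall fun _ => zero_le) ?_
  filter_upwards [eventually_ne_atTop 0] with n hn
  refine measure_mono fun ω hω => ?_
  simp only [Set.mem_ofPred_eq] at hω ⊢
  by_contra! hlt
  have hχ2 : μ / 2 < pairMean H n fun i => Y i ω := by
    rw [Real.norm_eq_abs, abs_lt] at hlt
    linarith [hlt.1]
  have hχ0 : (pairMean H n fun i => Y i ω) ≠ 0 := ((half_pos hμ).trans hχ2).ne'
  have hdec := sqrt_mul_pairMean_sub_stepMean (ν := ν) H hn fun i => Y i ω
  refine absurd hω (not_le.2 ?_)
  have hXW : X n ω = ((√(n : ℝ))⁻¹ * ∑ j ∈ Finset.range (n - 1),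
        -(degeneratePart ν H (Y j ω) (Y (j + 1) ω)) / μ
      + ((√(n : ℝ) * pairMean (degeneratePart ν H) n fun i => Y i ω) + (√(n : ℝ))⁻¹
      * (kernelProj ν H (Y 0 ω) + kernelProj ν H (Y (n - 1) ω) - kernelMean ν H)) / μ)
      * (μ * (max (pairMean H n fun i => Y i ω) (μ / 2))⁻¹) := by
    rw [max_eq_left hχ2.le, hX n ω hχ0, ← Finset.sum_div, Finset.sum_neg_distrib]
    have e1 : √(n : ℝ) * (1 - stepMean H n (fun i => Y i ω) / pairMean H n (fun i => Y i ω))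
        = (√(n : ℝ) * (pairMean H n (fun i => Y i ω) - stepMean H n (fun i => Y i ω)))
          * (pairMean H n (fun i => Y i ω))⁻¹ := by field_simp
    rw [e1, hdec]
    field_simp
  simp only [Pi.sub_apply, Pi.zero_apply, sub_zero]
  rw [hXW, sub_self, norm_zero]
  exact hε

end Slutsky

section Variance

variable {Ω S : Type*} [MeasurableSpace Ω] [MeasurableSpace S]
  {P : Measure Ω} [IsProbabilityMeasure P] {ν : Measure S} [IsProbabilityMeasure ν]
  {H : S → S → ℝ} {C : ℝ} {Y : ℕ → Ω → S}

omit [IsProbabilityMeasure P] [IsProbabilityMeasure ν] in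
lemma integral_comp_law {V : Ω → S} (hV : Measurable V) (hlaw : P.map V = ν) {f : S → ℝ}
    (hf : Measurable f) : ∫ ω, f (V ω) ∂P = ∫ x, f x ∂ν := by
  rw [← hlaw, integral_map hV.aemeasurable hf.aestronglyMeasurable]

lemma integral_sub_kernelProj (hH : Measurable (Function.uncurry H)) (hC : ∀ x y, |H x y| ≤ C)
    (x : S) : ∫ y, (H x y - kernelProj ν H x) ∂ν = 0 := by
  rw [integral_sub (integrable_of_measurable_of_norm_le hH.of_uncurry_left (hC x))
    (integrable_const _)]
  simp [kernelProj]

lemma integral_kernel_eq_kernelMean (hY : iIndepFun Y P) (hYm : ∀ i, Measurable (Y i))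
    (hlaw : ∀ i, P.map (Y i) = ν) (hH : Measurable (Function.uncurry H))
    (hC : ∀ x y, |H x y| ≤ C) : ∫ ω, H (Y 0 ω) (Y 1 ω) ∂P = kernelMean ν H := by
  have hpm := measurable_kernelProj (ν := ν) hH
  have hm : Measurable fun p : S × S => H p.1 p.2 := hH
  have h := integral_comp_eq_zero_of_indepFun (P := P) (ν := ν) (C := C + C) (hYm 0) (hYm 1)
    (hY.indepFun zero_ne_one) (hlaw 1) (m := fun x y => H x y - kernelProj ν H x)
    (hm.sub (hpm.comp measurable_fst))
    (fun x y => (norm_sub_le _ _).trans (add_le_add (hC x y) (abs_kernelProj_le hC x)))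
    (integral_sub_kernelProj hH hC)
  have i1 : Integrable (fun ω => H (Y 0 ω) (Y 1 ω)) P := integrable_of_measurable_of_norm_le
    (hm.comp ((hYm 0).prodMk (hYm 1))) fun ω => hC _ _
  have i2 : Integrable (fun ω => kernelProj ν H (Y 0 ω)) P := integrable_of_measurable_of_norm_le
    (hpm.comp (hYm 0)) fun ω => abs_kernelProj_le hC _
  rw [integral_sub i1 i2, integral_comp_law (hYm 0) (hlaw 0) hpm] at h
  exact sub_eq_zero.1 h

/-- The variance of the degenerate part, in terms of three observations. -/
lemma integral_condSecondMoment_degeneratePart (hY : iIndepFun Y P) (hYm : ∀ i, Measurable (Y i))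
    (hlaw : ∀ i, P.map (Y i) = ν) (hH : Measurable (Function.uncurry H))
    (hs : ∀ x y, H x y = H y x) (hC : ∀ x y, |H x y| ≤ C) :
    ∫ x, condSecondMoment ν (degeneratePart ν H) x ∂ν
      = ∫ ω, H (Y 0 ω) (Y 1 ω) ^ 2 ∂P - 2 * ∫ ω, H (Y 0 ω) (Y 1 ω) * H (Y 0 ω) (Y 2 ω) ∂P
        + kernelMean ν H ^ 2 := by
  have hm : Measurable fun p : S × S => H p.1 p.2 := hH
  have hpm := measurable_kernelProj (ν := ν) hH
  have hpC := abs_kernelProj_le (ν := ν) hC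
  have hgm := measurable_degeneratePart (ν := ν) hH
  have hgC := abs_degeneratePart_le (ν := ν) hC
  set p := kernelProj ν H with hp
  set μ := kernelMean ν H with hμ
  have hμC : |μ| ≤ C := abs_kernelMean_le hC
  have hmul : ∀ {a b A B : ℝ}, |a| ≤ A → |b| ≤ B → |a * b| ≤ A * B := fun {a b A B} ha hb => by
    rw [abs_mul]; exact mul_le_mul ha hb (abs_nonneg _) ((abs_nonneg _).trans ha)
  have hHp : ∀ x y z, |H x y - p z| ≤ C + C := fun x y z =>
    (abs_sub _ _).trans (add_le_add (hC x y) (hpC z))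
  have hg2 : ∫ x, condSecondMoment ν (degeneratePart ν H) x ∂ν
      = ∫ ω, degeneratePart ν H (Y 0 ω) (Y 1 ω) ^ 2 ∂P := by
    have h1 : ∀ x y, |degeneratePart ν H x y ^ 2| ≤ (4 * C) ^ 2 := fun x y => by
      rw [abs_pow]; exact pow_le_pow_left₀ (abs_nonneg _) (hgC x y) 2
    exact (integral_kernel_eq_kernelMean (H := fun x y => degeneratePart ν H x y ^ 2) hY hYm hlaw
      (hgm.pow_const 2) h1).symm
  have H01 := hm.comp ((hYm 0).prodMk (hYm 1))
  have H02 := hm.comp ((hYm 0).prodMk (hYm 2))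
  have p0 := hpm.comp (hYm 0)
  have p1 := hpm.comp (hYm 1)
  simp only [Function.comp_def] at H01 H02 p0 p1
  have t1 : ∫ ω, 2 * H (Y 0 ω) (Y 1 ω) * (H (Y 0 ω) (Y 2 ω) - p (Y 0 ω)) ∂P = 0 := by
    have hind : IndepFun (fun ω => (Y 0 ω, Y 1 ω)) (Y 2) P :=
      hY.indepFun_prodMk hYm 0 1 2 (by norm_num) (by norm_num)
    refine integral_comp_eq_zero_of_indepFun (ν := ν) (C := 2 * C * (C + C))
      (Z := fun ω => (Y 0 ω, Y 1 ω)) (V := Y 2)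
      (m := fun z y => 2 * H z.1 z.2 * (H z.1 y - p z.1)) ((hYm 0).prodMk (hYm 1)) (hYm 2) hind
      (hlaw 2) ?_ (fun z y => hmul (hmul (by norm_num) (hC _ _)) (hHp _ _ _)) fun z => ?_
    · have e1 : Measurable fun q : (S × S) × S => H q.1.1 q.1.2 := hm.comp measurable_fst
      have e2 : Measurable fun q : (S × S) × S => H q.1.1 q.2 :=
        hm.comp ((measurable_fst.comp measurable_fst).prodMk measurable_snd)
      simp only [Function.uncurry_def]
      fun_prop
    · rw [integral_const_mul, integral_sub_kernelProj hH hC, mul_zero]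
  have t2 : ∫ ω, (-2 * p (Y 1 ω)) * (H (Y 1 ω) (Y 0 ω) - p (Y 1 ω)) ∂P = 0 := by
    refine integral_comp_eq_zero_of_indepFun (ν := ν) (C := 2 * C * (C + C)) (hYm 1) (hYm 0)
      (hY.indepFun one_ne_zero) (hlaw 0) (m := fun z y => (-2 * p z) * (H z y - p z)) ?_
      (fun z y => hmul (hmul (by norm_num) (hpC _)) (hHp _ _ _)) fun z => ?_
    · simp only [Function.uncurry_def]
      fun_prop
    · rw [integral_const_mul, integral_sub_kernelProj hH hC, mul_zero]
  have i0 : Integrable (fun ω => p (Y 0 ω) ^ 2) P :=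
    integrable_of_measurable_of_norm_le (p0.pow_const 2) (C := C ^ 2) fun ω => by
      rw [norm_pow]; exact pow_le_pow_left₀ (norm_nonneg _) (hpC _) 2
  have i1 : Integrable (fun ω => p (Y 1 ω) ^ 2) P :=
    integrable_of_measurable_of_norm_le (p1.pow_const 2) (C := C ^ 2) fun ω => by
      rw [norm_pow]; exact pow_le_pow_left₀ (norm_nonneg _) (hpC _) 2
  have t3 : ∫ ω, (p (Y 0 ω) ^ 2 - p (Y 1 ω) ^ 2) ∂P = 0 := by
    rw [integral_sub i0 i1, integral_comp_law (hYm 0) (hlaw 0) (hpm.pow_const 2),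
      integral_comp_law (hYm 1) (hlaw 1) (hpm.pow_const 2), sub_self]
  have t4 : ∫ ω, 2 * μ * (H (Y 0 ω) (Y 1 ω) - p (Y 0 ω)) ∂P = 0 := by
    refine integral_comp_eq_zero_of_indepFun (ν := ν) (C := 2 * C * (C + C)) (hYm 0) (hYm 1)
      (hY.indepFun zero_ne_one) (hlaw 1) (m := fun z y => 2 * μ * (H z y - p z)) ?_
      (fun z y => hmul (hmul (by norm_num) hμC) (hHp _ _ _)) fun z => ?_
    · simp only [Function.uncurry_def]
      fun_prop
    · rw [integral_const_mul, integral_sub_kernelProj hH hC, mul_zero]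
  have t5 : ∫ ω, 2 * p (Y 1 ω) * (p (Y 0 ω) - μ) ∂P = 0 := by
    refine integral_comp_eq_zero_of_indepFun (ν := ν) (C := 2 * C * (C + C)) (hYm 1) (hYm 0)
      (hY.indepFun one_ne_zero) (hlaw 0) (m := fun z y => 2 * p z * (p y - μ)) ?_
      (fun z y => hmul (hmul (by norm_num) (hpC _))
        ((abs_sub _ _).trans (add_le_add (hpC y) hμC))) fun z => ?_
    · simp only [Function.uncurry_def]
      fun_prop
    · rw [integral_const_mul, integral_sub (integrable_kernelProj hH hC) (integrable_const _)]
      simp [hμ, hp, kernelMean]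
  have I1 : Integrable (fun ω => 2 * H (Y 0 ω) (Y 1 ω) * (H (Y 0 ω) (Y 2 ω) - p (Y 0 ω))) P :=
    integrable_of_measurable_of_norm_le (by fun_prop) (C := 2 * C * (C + C))
      fun ω => hmul (hmul (by norm_num) (hC _ _)) (hHp _ _ _)
  have H10 : Measurable fun ω => H (Y 1 ω) (Y 0 ω) := hm.comp ((hYm 1).prodMk (hYm 0))
  have I2 : Integrable (fun ω => (-2 * p (Y 1 ω)) * (H (Y 1 ω) (Y 0 ω) - p (Y 1 ω))) P :=
    integrable_of_measurable_of_norm_le (by fun_prop) (C := 2 * C * (C + C))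
      fun ω => hmul (hmul (by norm_num) (hpC _)) (hHp _ _ _)
  have I4 : Integrable (fun ω => 2 * μ * (H (Y 0 ω) (Y 1 ω) - p (Y 0 ω))) P :=
    integrable_of_measurable_of_norm_le (by fun_prop) (C := 2 * C * (C + C))
      fun ω => hmul (hmul (by norm_num) hμC) (hHp _ _ _)
  have I5 : Integrable (fun ω => 2 * p (Y 1 ω) * (p (Y 0 ω) - μ)) P :=
    integrable_of_measurable_of_norm_le (by fun_prop) (C := 2 * C * (C + C))
      fun ω => hmul (hmul (by norm_num) (hpC _)) ((abs_sub _ _).trans (add_le_add (hpC _) hμC))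
  have J1 : Integrable (fun ω => H (Y 0 ω) (Y 1 ω) ^ 2) P :=
    integrable_of_measurable_of_norm_le (H01.pow_const 2) (C := C ^ 2) fun ω => by
      rw [norm_pow]; exact pow_le_pow_left₀ (norm_nonneg _) (hC _ _) 2
  have J2 : Integrable (fun ω => 2 * (H (Y 0 ω) (Y 1 ω) * H (Y 0 ω) (Y 2 ω))) P :=
    integrable_of_measurable_of_norm_le (by fun_prop) (C := 2 * (C * C))
      fun ω => hmul (by norm_num) (hmul (hC _ _) (hC _ _))
  -- Modulo the three target terms, the square splits into five terms of mean zero.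
  have key : ∀ ω, degeneratePart ν H (Y 0 ω) (Y 1 ω) ^ 2
      = (H (Y 0 ω) (Y 1 ω) ^ 2 - 2 * (H (Y 0 ω) (Y 1 ω) * H (Y 0 ω) (Y 2 ω)) + μ ^ 2)
        + ((2 * H (Y 0 ω) (Y 1 ω) * (H (Y 0 ω) (Y 2 ω) - p (Y 0 ω))
          + (-2 * p (Y 1 ω)) * (H (Y 1 ω) (Y 0 ω) - p (Y 1 ω)))
          + ((p (Y 0 ω) ^ 2 - p (Y 1 ω) ^ 2) + (2 * μ * (H (Y 0 ω) (Y 1 ω) - p (Y 0 ω))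
            + 2 * p (Y 1 ω) * (p (Y 0 ω) - μ)))) := fun ω => by
    rw [hs (Y 1 ω) (Y 0 ω)]
    simp only [degeneratePart, ← hp, ← hμ]
    ring
  have K12 := I1.add I2
  have K45 := I4.add I5
  have K3 := i0.sub i1
  have K345 := K3.add K45
  have K := K12.add K345
  have J12 := J1.sub J2
  have J := J12.add (integrable_const (μ ^ 2))
  simp only [Pi.add_def, Pi.sub_def] at K12 K45 K3 K345 K J12 J
  rw [hg2, integral_congr_ae (ae_of_all _ key), integral_add J K, integral_add K12 K345,
    integral_add I1 I2, integral_add K3 K45, integral_add I4 I5, t1, t2, t3, t4, t5,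
    integral_add J12 (integrable_const _), integral_sub J1 J2, integral_const_mul]
  simp

end Variance

section Positivity

variable {ν : Measure ℝ} [IsProbabilityMeasure ν] {H : ℝ → ℝ → ℝ} {C : ℝ}

lemma continuous_kernelProj (hH : Continuous (Function.uncurry H)) (hC : ∀ x y, |H x y| ≤ C) :
    Continuous (kernelProj ν H) :=
  continuous_of_dominated (bound := fun _ => C)
    (fun x => (hH.comp (Continuous.prodMk_right x)).aestronglyMeasurable)
    (fun x => ae_of_all _ fun y => hC x y) (integrable_const C)
    (ae_of_all _ fun y => hH.comp (Continuous.prodMk_left y))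

omit [IsProbabilityMeasure ν] in
lemma eq_zero_of_mem_support_of_ae_eq_zero {f : ℝ → ℝ} (hf : Continuous f)
    (h0 : ∀ᵐ x ∂ν, f x = 0) {x : ℝ} (hx : x ∈ ν.support) : f x = 0 := by
  by_contra hne
  have hU : {y | f y ≠ 0} ∈ nhds x := (isOpen_ne_fun hf continuous_const).mem_nhds hne
  exact ((ν.mem_support_iff_forall x).1 hx _ hU).ne' (ae_iff.1 h0)

lemma kernelMean_pos (hH : Measurable (Function.uncurry H)) (hC : ∀ x y, |H x y| ≤ C)
    (h0 : ∀ x y, 0 ≤ H x y) (hpos : ∀ x y, x ≠ y → 0 < H x y)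
    (hν : ¬ ∃ c : ℝ, ∀ᵐ x ∂ν, x = c) : 0 < kernelMean ν H := by
  have hp0 : ∀ x, 0 ≤ kernelProj ν H x := fun x => integral_nonneg (h0 x)
  refine lt_of_le_of_ne (integral_nonneg hp0) fun h => hν ?_
  have h1 := (integral_eq_zero_iff_of_nonneg hp0 (integrable_kernelProj hH hC)).1 h.symm
  obtain ⟨c, hc⟩ := h1.exists
  refine ⟨c, ?_⟩
  have h2 := (integral_eq_zero_iff_of_nonneg (h0 c)
    (integrable_of_measurable_of_norm_le hH.of_uncurry_left (hC c))).1 hc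
  filter_upwards [h2] with y hy
  by_contra hne
  exact (hpos c y (Ne.symm hne)).ne' hy

lemma integral_condSecondMoment_degeneratePart_pos (hH : Continuous (Function.uncurry H))
    (hC : ∀ x y, |H x y| ≤ C) (hdiag : ∀ x, H x x = 0) (hμ : 0 < kernelMean ν H) :
    0 < ∫ x, condSecondMoment ν (degeneratePart ν H) x ∂ν := by
  have hgm := measurable_degeneratePart (ν := ν) hH.measurable
  have hgC := abs_degeneratePart_le (ν := ν) hC
  have hv := condSecondMoment_mem_Icc (ν := ν) hgm hgC
  refine lt_of_le_of_ne (integral_nonneg fun x => (hv x).1) fun h => ?_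
  have h1 := (integral_eq_zero_iff_of_nonneg (fun x => (hv x).1)
    (integrable_condSecondMoment hgm hgC)).1 h.symm
  have hpc := continuous_kernelProj (ν := ν) hH hC
  have hhalf : ∀ᵐ x ∂ν, kernelProj ν H x = kernelMean ν H / 2 := by
    filter_upwards [h1, ν.support_mem_ae] with x hx hxs
    have hcont : Continuous (degeneratePart ν H x) := by
      have : Continuous fun y => H x y := hH.comp (Continuous.prodMk_right x)
      unfold degeneratePart
      fun_prop
    have h2 := (integral_eq_zero_iff_of_nonneg (fun y => sq_nonneg (degeneratePart ν H x y))
      (integrable_of_measurable_of_norm_le (hcont.measurable.pow_const 2) (C := (4 * C) ^ 2)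
        fun y => by rw [norm_pow]; exact pow_le_pow_left₀ (norm_nonneg _) (hgC x y) 2)).1 hx
    have h3 := eq_zero_of_mem_support_of_ae_eq_zero hcont
      (h2.mono fun y hy => pow_eq_zero_iff two_ne_zero |>.1 hy) hxs
    rw [degeneratePart, hdiag] at h3
    linarith
  have h4 : kernelMean ν H = kernelMean ν H / 2 := by
    conv_lhs => rw [kernelMean, integral_congr_ae hhalf]
    simp
  linarith

end Positivity

/-! ### Random orderings and the correlation coefficient -/

section Ordering

variable {Ω : Type*} [MeasurableSpace Ω] {P : Measure Ω} [IsProbabilityMeasure P] {n : ℕ}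

lemma sortingPerms_nonempty (x : Fin n → ℝ) : (sortingPerms x).Nonempty :=
  ⟨Tuple.sort x, Tuple.monotone_sort x⟩

lemma measurableSet_mem_sortingPerms (σ : Equiv.Perm (Fin n)) :
    MeasurableSet {x : Fin n → ℝ | σ ∈ sortingPerms x} := by
  have : {x : Fin n → ℝ | σ ∈ sortingPerms x}
      = ⋂ i, ⋂ j, ⋂ (_ : i ≤ j), {x : Fin n → ℝ | x (σ i) ≤ x (σ j)} := by
    ext x
    simp [sortingPerms, Monotone]
  rw [this]
  exact MeasurableSet.iInter fun i => MeasurableSet.iInter fun j => MeasurableSet.iInter fun _ =>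
    measurableSet_le (measurable_pi_apply _) (measurable_pi_apply _)

/-- The probability of `σ` under the uniform distribution on the permutations that sort `x`. -/
noncomputable def sortingWeight (σ : Equiv.Perm (Fin n)) (x : Fin n → ℝ) : ℝ≥0∞ :=
  (sortingPerms x).indicator (fun _ => ((sortingPerms x).ncard : ℝ≥0∞)⁻¹) σ

lemma sum_sortingWeight (x : Fin n → ℝ) : ∑ σ, sortingWeight σ x = 1 := by
  classical
  have h0 : (sortingPerms x).ncard ≠ 0 :=
    Set.ncard_ne_zero_of_mem (sortingPerms_nonempty x).some_mem
  have h1 : ∑ σ, sortingWeight σ x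
      = ((sortingPerms x).ncard : ℝ≥0∞) * ((sortingPerms x).ncard : ℝ≥0∞)⁻¹ := by
    simp only [sortingWeight, Set.indicator_apply]
    rw [← Finset.sum_filter, Finset.sum_const, nsmul_eq_mul, Set.ncard_eq_toFinset_card']
    congr 3
    ext; simp
  rw [h1, ENNReal.mul_inv_cancel (by exact_mod_cast h0) (by simp)]

lemma measurable_sortingWeight (σ : Equiv.Perm (Fin n)) : Measurable (sortingWeight σ) := by
  classical
  have h1 : ∀ x : Fin n → ℝ, ((sortingPerms x).ncard : ℝ≥0∞)
      = ∑ τ, ({x : Fin n → ℝ | τ ∈ sortingPerms x}.indicator (fun _ => (1 : ℝ≥0∞)) x) := fun x => by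
    simp only [Set.indicator_apply, Set.mem_ofPred_eq]
    rw [← Finset.sum_filter, Finset.sum_const, nsmul_eq_mul, mul_one, Set.ncard_eq_toFinset_card']
    congr 2
    ext; simp
  have h2 : Measurable fun x : Fin n → ℝ => ((sortingPerms x).ncard : ℝ≥0∞) := by
    simp_rw [h1]
    exact Finset.measurable_fun_sum _ fun τ _ =>
      measurable_const.indicator (measurableSet_mem_sortingPerms τ)
  exact (h2.inv).indicator (measurableSet_mem_sortingPerms σ)

/-- A uniform random ordering by covariates independent of an exchangeable vector does not change
the law of that vector. -/
theorem IsUniformOrdering.map_comp_eq {x y : Fin n → Ω → ℝ} {π : Ω → Equiv.Perm (Fin n)}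
    (hπ : IsUniformOrdering P x y π) (hx : ∀ i, Measurable (x i)) (hy : ∀ i, Measurable (y i))
    (hxy : IndepFun (fun ω i => x i ω) (fun ω i => y i ω) P)
    (hexch : ∀ σ : Equiv.Perm (Fin n),
      P.map (fun ω i => y (σ i) ω) = P.map (fun ω i => y i ω)) :
    Measurable (fun ω i => y (π ω i) ω) ∧
      P.map (fun ω i => y (π ω i) ω) = P.map (fun ω i => y i ω) := by
  have hxm : Measurable fun ω i => x i ω := measurable_pi_lambda _ hx
  have hym : ∀ σ : Equiv.Perm (Fin n), Measurable fun ω i => y (σ i) ω := fun σ =>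
    measurable_pi_lambda _ fun i => hy (σ i)
  have hdecomp : ∀ A : Set (Fin n → ℝ), (fun ω i => y (π ω i) ω) ⁻¹' A
      = ⋃ σ : Equiv.Perm (Fin n), {ω | (fun i => y (σ i) ω) ∈ A ∧ π ω = σ} := fun A => by
    ext ω
    simp
  have hpiece : ∀ {A : Set (Fin n → ℝ)}, MeasurableSet A → ∀ σ : Equiv.Perm (Fin n),
      MeasurableSet {ω | (fun i => y (σ i) ω) ∈ A ∧ π ω = σ} := fun {A} hA σ =>
    ((hym σ) hA).inter (hπ.measurableSet_eq σ)
  have hmeas : Measurable (fun ω i => y (π ω i) ω) := fun A hA => by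
    rw [hdecomp]
    exact MeasurableSet.iUnion fun σ => hpiece hA σ
  refine ⟨hmeas, Measure.ext fun A hA => ?_⟩
  rw [Measure.map_apply hmeas hA, hdecomp, measure_iUnion ?_ (hpiece hA), tsum_fintype]
  · have hterm : ∀ σ : Equiv.Perm (Fin n), P {ω | (fun i => y (σ i) ω) ∈ A ∧ π ω = σ}
        = P.map (fun ω i => y i ω) A * ∫⁻ ω, sortingWeight σ (fun i => x i ω) ∂P := fun σ => by
      have hB : MeasurableSet {p : Fin n → ℝ × ℝ | (fun i => (p (σ i)).2) ∈ A} :=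
        (measurable_pi_lambda (fun (p : Fin n → ℝ × ℝ) i => (p (σ i)).2)
          fun i => measurable_snd.comp (measurable_pi_apply _)) hA
      have h1 := hπ.condLaw σ _ hB
      simp only [Set.mem_ofPred_eq] at h1
      rw [h1]
      have hAσ : MeasurableSet {ω | (fun i => y (σ i) ω) ∈ A} := hym σ hA
      rw [← lintegral_indicator hAσ]
      have h2 : ∀ ω, {ω | (fun i => y (σ i) ω) ∈ A}.indicator (fun ω =>
          (sortingPerms fun i => x i ω).indicator
            (fun _ => ((sortingPerms fun i => x i ω).ncard : ℝ≥0∞)⁻¹) σ) ω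
          = (fun z : Fin n → ℝ => A.indicator (fun _ => (1 : ℝ≥0∞)) fun i => z (σ i))
              (fun i => y i ω) * sortingWeight σ (fun i => x i ω) := fun ω => by
        by_cases h : (fun i => y (σ i) ω) ∈ A <;> simp [Set.indicator, h, sortingWeight]
      simp_rw [h2]
      have hAm : Measurable fun z : Fin n → ℝ => A.indicator (fun _ => (1 : ℝ≥0∞)) fun i => z (σ i) :=
        (measurable_const.indicator hA).comp
          (measurable_pi_lambda _ fun i => measurable_pi_apply (σ i))
      have h3 := lintegral_mul_eq_lintegral_mul_lintegral_of_indepFun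
        (μ := P) (f := fun ω => (fun z : Fin n → ℝ => A.indicator (fun _ => (1 : ℝ≥0∞))
          fun i => z (σ i)) (fun i => y i ω))
        (g := fun ω => sortingWeight σ (fun i => x i ω))
        (hAm.comp (hym 1)) ((measurable_sortingWeight σ).comp hxm)
        (hxy.symm.comp hAm (measurable_sortingWeight σ))
      simp only [Pi.mul_apply] at h3
      rw [h3]
      congr 1
      rw [← hexch σ, Measure.map_apply (hym σ) hA, ← lintegral_indicator_one ((hym σ) hA)]
      rfl
    simp_rw [hterm]
    have hw : ∀ σ ∈ (Finset.univ : Finset (Equiv.Perm (Fin n))),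
        Measurable fun ω => sortingWeight σ fun i => x i ω := fun σ _ =>
      (measurable_sortingWeight σ).comp hxm
    rw [← Finset.mul_sum, ← lintegral_finsetSum _ hw]
    simp [sum_sortingWeight]
  · intro σ τ hστ
    rw [Function.onFun, Set.disjoint_left]
    rintro ω ⟨_, h1⟩ ⟨_, h2⟩
    exact hστ (h1.symm.trans h2)

omit [IsProbabilityMeasure P] in
lemma map_comp_perm_eq_of_iid {Y : ℕ → Ω → ℝ} (hY : iIndepFun Y P)
    (hYm : ∀ i, Measurable (Y i)) {ν : Measure ℝ} (hlaw : ∀ i, P.map (Y i) = ν)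
    (σ : Equiv.Perm (Fin n)) :
    P.map (fun ω (i : Fin n) => Y (σ i) ω) = P.map (fun ω (i : Fin n) => Y i ω) := by
  have h1 := (hY.precomp (g := fun i : Fin n => ((σ i : Fin n) : ℕ))
    (Fin.val_injective.comp σ.injective)).map_fun_eq_pi_map fun i => (hYm _).aemeasurable
  have h2 := (hY.precomp (g := fun i : Fin n => (i : ℕ)) Fin.val_injective).map_fun_eq_pi_map
    fun i => (hYm _).aemeasurable
  rw [h1, h2]
  simp_rw [hlaw]

/-- Independence within each pair of an i.i.d. sequence of pairs yields independence of the two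
coordinate vectors. -/
lemma indepFun_vectors_of_iid {X Y : Ω → ℝ} (hX : Measurable X) (hY : Measurable Y)
    (hXY : IndepFun X Y P) {Xs Ys : ℕ → Ω → ℝ} (hXs : ∀ i, Measurable (Xs i))
    (hYs : ∀ i, Measurable (Ys i)) (hindep : iIndepFun (fun i ω => (Xs i ω, Ys i ω)) P)
    (hident : ∀ i, IdentDistrib (fun ω => (Xs i ω, Ys i ω)) (fun ω => (X ω, Y ω)) P P) (n : ℕ) :
    IndepFun (fun ω (i : Fin n) => Xs i ω) (fun ω (i : Fin n) => Ys i ω) P := by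
  have hXp := Measure.isProbabilityMeasure_map (μ := P) hX.aemeasurable
  have hYp := Measure.isProbabilityMeasure_map (μ := P) hY.aemeasurable
  have h1 : P.map (fun ω (i : Fin n) => (Xs i ω, Ys i ω))
      = Measure.pi fun _ : Fin n => (P.map X).prod (P.map Y) := by
    rw [(hindep.precomp (g := fun i : Fin n => (i : ℕ)) Fin.val_injective).map_fun_eq_pi_map
      fun i => ((hXs _).prodMk (hYs _)).aemeasurable]
    congr 1
    ext1 i
    rw [(hident i).map_eq]
    exact (indepFun_iff_map_prod_eq_prod_map_map hX.aemeasurable hY.aemeasurable).1 hXY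
  have hpair : Measurable fun ω (i : Fin n) => (Xs i ω, Ys i ω) :=
    measurable_pi_lambda _ fun i => (hXs i).prodMk (hYs i)
  have hmp := measurePreserving_arrowProdEquivProdArrow ℝ ℝ (Fin n) (fun _ => P.map X)
    (fun _ => P.map Y)
  have h2 : P.map (fun ω => ((fun i : Fin n => Xs i ω), fun i : Fin n => Ys i ω))
      = (Measure.pi fun _ : Fin n => P.map X).prod (Measure.pi fun _ : Fin n => P.map Y) := by
    rw [← hmp.map_eq, ← h1, Measure.map_map hmp.measurable hpair]
    rfl
  have hXv : Measurable fun ω (i : Fin n) => Xs i ω := measurable_pi_lambda _ fun i => hXs i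
  have hYv : Measurable fun ω (i : Fin n) => Ys i ω := measurable_pi_lambda _ fun i => hYs i
  rw [indepFun_iff_map_prod_eq_prod_map_map hXv.aemeasurable hYv.aemeasurable, h2]
  have h3 := congrArg Measure.fst h2
  have h4 := congrArg Measure.snd h2
  rw [Measure.fst_map_prodMk hYv, Measure.fst_prod] at h3
  rw [Measure.snd_map_prodMk hXv, Measure.snd_prod] at h4
  rw [h3, h4]

end Ordering

lemma tendstoInDistribution_of_map_eq {Ω Ω' : Type*} [MeasurableSpace Ω] [MeasurableSpace Ω']
    {P : Measure Ω} [IsProbabilityMeasure P] {P' : Measure Ω'} [IsProbabilityMeasure P']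
    {X X' : ℕ → Ω → ℝ} {Z : Ω' → ℝ}
    (hX : TendstoInDistribution X atTop Z (fun _ => P) P') (hX' : ∀ n, AEMeasurable (X' n) P)
    (h : ∀ n, P.map (X' n) = P.map (X n)) :
    TendstoInDistribution X' atTop Z (fun _ => P) P' where
  forall_aemeasurable := hX'
  aemeasurable_limit := hX.aemeasurable_limit
  tendsto := by
    refine hX.tendsto.congr fun n => ?_
    exact Subtype.ext (h n).symm

section Statistic

variable {h : ℝ → ℝ → ℝ} {F : ℝ → ℝ}

lemma xiStat_eq_xiStat_one {n : ℕ} (y : Fin n → ℝ) (σ : Equiv.Perm (Fin n)) :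
    xiStat h F y σ = xiStat h F (fun i => y (σ i)) 1 := by
  have : chiStat h F (fun i => y (σ i)) = chiStat h F y := by
    unfold chiStat
    congr 1
    rw [← Equiv.sum_comp σ fun i => ∑ j, h (F (y i)) (F (y j))]
    exact Finset.sum_congr rfl fun i _ => Equiv.sum_comp σ fun j => h (F (y (σ i))) (F (y j))
  simp [xiStat, this]

lemma chiStat_eq_pairMean (n : ℕ) (y : ℕ → ℝ) :
    chiStat h F (fun i : Fin n => y i) = pairMean (fun a b => h (F a) (F b)) n y := by
  simp [chiStat, pairMean, Finset.sum_range]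

lemma zetaStat_eq_stepMean (n : ℕ) (y : ℕ → ℝ) :
    zetaStat h F (fun i : Fin n => y i) = stepMean (fun a b => h (F a) (F b)) n y := by
  simp [zetaStat, stepMean, Finset.sum_range]

lemma measurable_xiStat_one (hH : Measurable (Function.uncurry fun a b => h (F a) (F b))) (n : ℕ) :
    Measurable fun y : Fin n → ℝ => xiStat h F y 1 := by
  have hij : ∀ i j : Fin n, Measurable fun y : Fin n → ℝ => h (F (y i)) (F (y j)) := fun i j =>
    hH.comp (f := fun y : Fin n → ℝ => (y i, y j))
      ((measurable_pi_apply i).prodMk (measurable_pi_apply j))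
  have hχ : Measurable fun y : Fin n → ℝ => chiStat h F y :=
    (Finset.measurable_fun_sum _ fun i _ => Finset.measurable_fun_sum _ fun j _ =>
      hij i j).const_mul _
  have hζ : Measurable fun y : Fin n → ℝ => zetaStat h F y :=
    (Finset.measurable_fun_sum _ fun i _ => hij _ _).const_mul _
  exact Measurable.ite (hχ (measurableSet_singleton 0)) measurable_const
    (measurable_const.sub (hζ.div hχ))

lemma RegularKernel.continuous_comp (hh : RegularKernel h) (hF : RegularCdf F) :
    Continuous (Function.uncurry fun a b => h (F a) (F b)) :=
  hh.continuousOn.comp_continuous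
    ((hF.continuous.comp continuous_fst).prodMk (hF.continuous.comp continuous_snd))
    fun p => ⟨Set.Ioo_subset_Icc_self (hF.mem_Ioo p.1), Set.Ioo_subset_Icc_self (hF.mem_Ioo p.2)⟩

lemma RegularKernel.exists_bound (hh : RegularKernel h) (hF : RegularCdf F) :
    ∃ C, ∀ a b, |h (F a) (F b)| ≤ C := by
  obtain ⟨C, hC⟩ := (isCompact_Icc.prod isCompact_Icc).exists_bound_of_continuousOn hh.continuousOn
  exact ⟨C, fun a b => hC (F a, F b)
    ⟨Set.Ioo_subset_Icc_self (hF.mem_Ioo a), Set.Ioo_subset_Icc_self (hF.mem_Ioo b)⟩⟩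

end Statistic

theorem theorem3 {Ω : Type*} [MeasurableSpace Ω] (P : Measure Ω) [IsProbabilityMeasure P]
    (h : ℝ → ℝ → ℝ) (hh : RegularKernel h)
    (F : ℝ → ℝ) (hF : RegularCdf F)
    (X Y : Ω → ℝ) (hX : Measurable X) (hY : Measurable Y)
    (hY_nonconst : ¬ ∃ c : ℝ, ∀ᵐ ω ∂P, Y ω = c)
    (hXY : IndepFun X Y P)
    (Xs Ys : ℕ → Ω → ℝ) (hXs : ∀ i, Measurable (Xs i)) (hYs : ∀ i, Measurable (Ys i))
    (hindep : iIndepFun (fun i ω => (Xs i ω, Ys i ω)) P)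
    (hident : ∀ i, IdentDistrib (fun ω => (Xs i ω, Ys i ω)) (fun ω => (X ω, Y ω)) P P)
    (π : (n : ℕ) → Ω → Equiv.Perm (Fin n))
    (hπ : ∀ n, IsUniformOrdering P (fun i : Fin n => Xs i) (fun i : Fin n => Ys i) (π n)) :
    0 < sigmaSq P h F (Ys 0) (Ys 1) (Ys 2) ∧
      TendstoInDistribution
        (fun (n : ℕ) ω => √(n : ℝ) * xiStat h F (fun i : Fin n => Ys i ω) (π n ω))
        atTop (id : ℝ → ℝ) (fun _ => P)
        (gaussianReal 0 (sigmaSq P h F (Ys 0) (Ys 1) (Ys 2)).toNNReal) := by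
  obtain ⟨C, hC⟩ := hh.exists_bound hF
  have hHc := hh.continuous_comp hF
  have hI : ∀ a, F a ∈ Set.Icc (0 : ℝ) 1 := fun a => Set.Ioo_subset_Icc_self (hF.mem_Ioo a)
  set H : ℝ → ℝ → ℝ := fun a b => h (F a) (F b) with hHdef
  have hHm : Measurable (Function.uncurry H) := hHc.measurable
  have hHs : ∀ a b, H a b = H b a := fun a b => hh.symm _ (hI a) _ (hI b)
  set ν := P.map Y with hν
  have hνp : IsProbabilityMeasure ν := Measure.isProbabilityMeasure_map hY.aemeasurable
  have hYind : iIndepFun Ys P := hindep.comp (fun _ => Prod.snd) fun _ => measurable_snd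
  have hlaw : ∀ i, P.map (Ys i) = ν := fun i => ((hident i).comp measurable_snd).map_eq
  have hμ : 0 < kernelMean ν H := by
    refine kernelMean_pos hHm hC (fun a b => hh.nonneg _ (hI a) _ (hI b))
      (fun a b hab => hh.pos _ (hI a) _ (hI b) (hF.strictMono.injective.ne hab)) ?_
    rintro ⟨c, hc⟩
    exact hY_nonconst ⟨c, ae_of_ae_map hY.aemeasurable hc⟩
  have hσ : sigmaSq P h F (Ys 0) (Ys 1) (Ys 2)
      = (∫ x, condSecondMoment ν (degeneratePart ν H) x ∂ν) / kernelMean ν H ^ 2 := by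
    rw [integral_condSecondMoment_degeneratePart hYind hYs hlaw hHm hHs hC,
      ← integral_kernel_eq_kernelMean hYind hYs hlaw hHm hC]
    rfl
  refine ⟨?_, ?_⟩
  · rw [hσ]
    exact div_pos (integral_condSecondMoment_degeneratePart_pos hHc hC
      (fun a => hh.diag _ (hI a)) hμ) (by positivity)
  rw [hσ]
  have hΨ := fun n => measurable_xiStat_one (h := h) (F := F) hHm n
  have hYv : ∀ n, Measurable fun ω (i : Fin n) => Ys i ω := fun n =>
    measurable_pi_lambda _ fun i => hYs i
  have hid : TendstoInDistribution
      (fun (n : ℕ) ω => √(n : ℝ) * xiStat h F (fun i : Fin n => Ys i ω) 1)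
      atTop (id : ℝ → ℝ) (fun _ => P) (gaussianReal 0
        ((∫ x, condSecondMoment ν (degeneratePart ν H) x ∂ν) / kernelMean ν H ^ 2).toNNReal) := by
    refine tendstoInDistribution_sqrt_mul_one_sub_div hYind hYs hlaw hHm hHs hC hμ
      (fun n => ((hΨ n).comp (hYv n)).const_mul _) fun n ω hne => ?_
    have hχ := chiStat_eq_pairMean (h := h) (F := F) n fun i => Ys i ω
    have hζ := zetaStat_eq_stepMean (h := h) (F := F) n fun i => Ys i ω
    simp only [xiStat, Equiv.Perm.coe_one, id_eq]
    rw [hχ, hζ, if_neg hne]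
  have hperm := fun n => (hπ n).map_comp_eq (fun i => hXs i) (fun i => hYs i)
    (indepFun_vectors_of_iid hX hY hXY hXs hYs hindep hident n)
    (fun σ => map_comp_perm_eq_of_iid hYind hYs hlaw σ)
  have hrw : ∀ (n : ℕ) ω, √(n : ℝ) * xiStat h F (fun i : Fin n => Ys i ω) (π n ω)
      = (fun y : Fin n → ℝ => √(n : ℝ) * xiStat h F y 1) fun i => Ys (π n ω i) ω :=
    fun n ω => by rw [xiStat_eq_xiStat_one]
  simp_rw [hrw]
  refine tendstoInDistribution_of_map_eq hid
    (fun n => (((hΨ n).const_mul _).comp (hperm n).1).aemeasurable) fun n => ?_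
  have h1 := Measure.map_map (μ := P) ((hΨ n).const_mul √(n : ℝ)) (hperm n).1
  have h2 := Measure.map_map (μ := P) ((hΨ n).const_mul √(n : ℝ)) (hYv n)
  rw [(hperm n).2, h2] at h1
  exact h1.symm
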